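/- Fix an integer $k\ge 1$. For $n\ge 1$ let $\mathcal M_{n,k}$ be the set of all $k$-out maps on $[n]=\{1,\dots,n\}$, that is, of all maps $[n]\to[n]^k$ (equivalently, directed multigraphs on $[n]$ in which every vertex has exactly $k$ out-arcs, labelled $1,\dots,k$). For $\alpha\in(0,\infty)$ let $M_{n,k}^{\alpha}$ be the random $k$-out map generated as follows: start with the empty digraph on $[n]$, every vertex having weight $\alpha$; at each of $kn$ steps, choose uniformly at random a vertex whose current out-degree is below $k$, insert an arc from it to a target vertex chosen with probability proportional to the current weights, and increase the weight of the target by $1$; the out-arcs of each vertex are labelled $1,\dots,k$ in chronological order. Let $M_{n,k}^{\infty}$ be uniformly distributed on $\mathcal M_{n,k}$. Let $$d_{TV}(M_{n,k}^{\alpha},M_{n,k}^{\infty}):=\sup_{\mathcal A\subseteq\mathcal M_{n,k}}\bigl|P(M_{n,k}^{\alpha}\in\mathcal A)-P(M_{n,k}^{\infty}\in\mathcal A)\bigr|=\frac12\sum_{M\in\mathcal M_{n,k}}\bigl|P(M_{n,k}^{\alpha}=M)-P(M_{n,k}^{\infty}=M)\bigr|.$$ Let $\alpha=\alpha(n)\in(0,\infty)$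 and $n\to\infty$, with $k$ fixed. (i) If $\alpha/\sqrt n\to\infty$, then $d_{TV}(M_{n,k}^{\alpha},M_{n,k}^{\infty})\to0$. (ii) If $\alpha\to\infty$ and $\alpha/\sqrt n\to0$, then $d_{TV}(M_{n,k}^{\alpha},M_{n,k}^{\infty})\to1$. (iii) If $\alpha=\beta\sqrt n$ with $\beta\in(0,\infty)$ fixed, then $d_{TV}(M_{n,k}^{\alpha},M_{n,k}^{\infty})\to\tfrac12\,\mathbb E\bigl|1-e^{-\mathcal N}\bigr|$, where $\mathcal N$ is a Gaussian random variable with mean $k^2/(4\beta^2)$ and variance $k^2/(2\beta^2)$. -/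

import Mathlib

open Filter Topology ProbabilityTheory

noncomputable section

namespace KOut

/-- The `k`-out maps on the vertex set `[n]`, i.e. the maps `[n] → [n]^k`: `M v i` is the target
of the `i`-th out-arc of the vertex `v`. -/
abbrev KOutMap (n k : ℕ) : Type := Fin n → Fin k → Fin n

instance (n k : ℕ) : Nonempty (KOutMap n k) := ⟨fun v _ => v⟩

/-- A partially built `k`-out digraph: `s v i = some j` when the `i`-th out-arc of `v` has been
inserted and points to `j`, and `s v i = none` when it has not been inserted yet. -/
abbrev PartialMap (n k : ℕ) : Type := Fin n → Fin k → Option (Fin n)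

variable {n k : ℕ}

/-- The current out-degree of `v`. -/
def outDeg (s : PartialMap n k) (v : Fin n) : ℕ :=
  (Finset.univ.filter fun i : Fin k => (s v i).isSome).card

/-- The current in-degree of `j`, counted with multiplicity. -/
def inDeg (s : PartialMap n k) (j : Fin n) : ℕ :=
  (Finset.univ.filter fun a : Fin n × Fin k => s a.1 a.2 = some j).card

/-- The vertices whose current out-degree is below `k`. -/
def unsaturated (s : PartialMap n k) : Finset (Fin n) :=
  Finset.univ.filter fun v => outDeg s v < k

/-- Insert an arc from `v` to `j`. It gets the first free label of `v`, so that the out-arcs of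
each vertex are labelled chronologically. -/
def insertArc (s : PartialMap n k) (v j : Fin n) : PartialMap n k :=
  Function.update s v fun i => if (i : ℕ) = outDeg s v then some j else s v i

/-- The current weight of `j`: its initial weight `α` plus the number of times it was chosen. -/
def weight (α : Set.Ioi (0 : ℝ)) (s : PartialMap n k) (j : Fin n) : ENNReal :=
  ENNReal.ofReal ((α : ℝ) + inDeg s j)

theorem weight_tsum_ne_zero [Nonempty (Fin n)] (α : Set.Ioi (0 : ℝ)) (s : PartialMap n k) :
    ∑' j, weight α s j ≠ 0 := by
  intro h
  obtain ⟨j⟩ := ‹Nonempty (Fin n)›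
  have h1 := ENNReal.tsum_eq_zero.1 h j
  have h2 : (0 : ℝ) < α := α.2
  have h3 : (0 : ℝ) < (α : ℝ) + inDeg s j := by positivity
  exact absurd (ENNReal.ofReal_eq_zero.1 h1) (not_le.2 h3)

theorem weight_tsum_ne_top (α : Set.Ioi (0 : ℝ)) (s : PartialMap n k) :
    ∑' j, weight α s j ≠ ⊤ := by
  rw [tsum_fintype]
  exact ENNReal.sum_ne_top.2 fun j _ => ENNReal.ofReal_ne_top

/-- The law of the target of a new arc: proportional to the current weights. -/
def targetLaw [Nonempty (Fin n)] (α : Set.Ioi (0 : ℝ)) (s : PartialMap n k) : PMF (Fin n) :=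
  PMF.normalize (weight α s) (weight_tsum_ne_zero α s) (weight_tsum_ne_top α s)

/-- One step of the process: choose uniformly at random a vertex `v` of out-degree below `k`,
choose its target with probability proportional to the current weights, and insert the arc.
If every vertex has out-degree `k`, nothing happens. -/
def step (α : Set.Ioi (0 : ℝ)) (s : PartialMap n k) : PMF (PartialMap n k) :=
  if h : (unsaturated s).Nonempty then
    (PMF.uniformOfFinset (unsaturated s) h).bind fun v =>
      haveI : Nonempty (Fin n) := ⟨v⟩
      (targetLaw α s).map (insertArc s v)
  else PMF.pure s

/-- The law of the digraph after `t` steps, starting from the empty digraph. -/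
def process (n k : ℕ) (α : Set.Ioi (0 : ℝ)) : ℕ → PMF (PartialMap n k)
  | 0 => PMF.pure fun _ _ => none
  | t + 1 => (process n k α t).bind (step α)

/-- Read a full partial map as a `k`-out map. (The default value `v` is irrelevant: after `k * n`
steps all arcs are present with probability one.) -/
def toKOutMap (s : PartialMap n k) : KOutMap n k := fun v i => (s v i).getD v

/-- The law of the preferential attachment random `k`-out map: the terminal digraph of the
process, after `k * n` steps. -/
def prefLaw (n k : ℕ) (α : Set.Ioi (0 : ℝ)) : PMF (KOutMap n k) :=
  (process n k α (k * n)).map toKOutMap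

/-- The law of the uniformly random `k`-out map. -/
def unifLaw (n k : ℕ) : PMF (KOutMap n k) := PMF.uniformOfFintype (KOutMap n k)

/-- Total variation distance: the supremum over all events `A` of `|p(A) - q(A)|`. -/
def tvDist {Ω : Type} (p q : PMF Ω) : ℝ :=
  ⨆ A : Set Ω, |(p.toOuterMeasure A).toReal - (q.toOuterMeasure A).toReal|

end KOut

end

noncomputable section

namespace KOut

/-! Whichever vertex is selected at a step, the target `j` is drawn with probability `(α + inDeg j)
/ (n α + size)`. So the law of the terminal map does not depend on the insertion order and is a
Pólya urn law: a ratio of rising factorials in the in-degrees (`prefLaw_apply`). Its density with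
respect to the uniform law is `exp (logRatio α)` of the word of targets (`prefLaw_eq_exp_logRatio`),
so the total variation distance is the uniform average of `(1 - exp (logRatio α))⁺`
(`tvDist_eq_avg`).

Expanding the logarithms to second order gives, in L¹, `logRatio a ≈ centred / a - k² n / (4 a²)`
(`exists_logRatio_bound`), where `centred` is the centred number of pairs of equal letters, of order
`√n`. If `a ≫ √n`, both terms vanish; if `1 ≪ a ≪ √n`, the negative drift tends to infinity and
dominates the fluctuations; if `a = β √n`, both survive, and a Gaussian limit is needed.

That limit (`tendsto_avg_centred`) comes from characteristic functions in the manner of McLeish. The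
product of `(1 + i ε count) / (1 + i ε m / n)` along a uniform word has mean exactly one and is
close to `exp (i ε centred + ε² (psum 2 - msum 2) / 2)`. As `psum 2` concentrates and `mean₂ - msum
2 ≈ k² n / 2`, the choice `ε = θ / √n` yields the limit `exp (-θ² k² / 4)`. Stopping the product
when `psum 2` is large keeps it bounded (`norm_stoppedProd_sub_exp_le`). -/

/-- The average of `F` over all words of length `N` in the alphabet `Fin n`. -/
def avg {V : Type} [AddCommGroup V] [Module ℝ V] (n N : ℕ) (F : List (Fin n) → V) : V :=
  ((n : ℝ) ^ N)⁻¹ • ∑ f : Fin N → Fin n, F (List.ofFn f)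

/-! ### Averages over words. -/

section avg

variable {V : Type} [AddCommGroup V] [Module ℝ V] {n N : ℕ}

theorem avg_zero (F : List (Fin n) → V) : avg n 0 F = F [] := by
  simp [avg]

/-- Words grow at the head, so the inner average over `j` is the conditional expectation of one more
letter given the past `l`. All martingale arguments below go through this identity. -/
theorem avg_succ (F : List (Fin n) → V) :
    avg n (N + 1) F = avg n N fun l => (n : ℝ)⁻¹ • ∑ j, F (j :: l) := by
  unfold avg
  rw [← (Fin.consEquiv fun _ => Fin n).sum_comp, Fintype.sum_prod_type, Finset.sum_comm,
    ← Finset.smul_sum, smul_smul, pow_succ, mul_inv]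
  simp [Fin.consEquiv, List.ofFn_succ]

theorem avg_congr {F G : List (Fin n) → V} (h : ∀ l, l.length = N → F l = G l) :
    avg n N F = avg n N G := by
  unfold avg
  congr 1
  exact Finset.sum_congr rfl fun f _ => h _ (by simp)

theorem avg_add (F G : List (Fin n) → V) :
    avg n N (fun l => F l + G l) = avg n N F + avg n N G := by
  simp [avg, Finset.sum_add_distrib]

theorem avg_sub (F G : List (Fin n) → V) :
    avg n N (fun l => F l - G l) = avg n N F - avg n N G := by
  simp [avg, Finset.sum_sub_distrib, smul_sub]

theorem avg_mul_left (c : ℝ) (F : List (Fin n) → ℝ) :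
    avg n N (fun l => c * F l) = c * avg n N F := by
  simp only [avg, ← Finset.mul_sum, smul_eq_mul]
  ring

theorem avg_mul_left_complex (c : ℂ) (F : List (Fin n) → ℂ) :
    avg n N (fun l => c * F l) = c * avg n N F := by
  simp only [avg, ← Finset.mul_sum, mul_smul_comm]

theorem avg_const (hn : n ≠ 0) (c : V) : avg n N (fun _ => c) = c := by
  have : ((n : ℝ) ^ N) ≠ 0 := by positivity
  simp only [avg, Finset.sum_const, Finset.card_univ, Fintype.card_fun, Fintype.card_fin]
  rw [← Nat.cast_smul_eq_nsmul ℝ, smul_smul]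
  simp [this]

theorem avg_mono {F G : List (Fin n) → ℝ} (h : ∀ l, l.length = N → F l ≤ G l) :
    avg n N F ≤ avg n N G := by
  unfold avg
  exact smul_le_smul_of_nonneg_left (Finset.sum_le_sum fun f _ => h _ (by simp)) (by positivity)

theorem avg_nonneg {F : List (Fin n) → ℝ} (h : ∀ l, 0 ≤ F l) : 0 ≤ avg n N F := by
  unfold avg
  exact smul_nonneg (by positivity) (Finset.sum_nonneg fun f _ => h _)

theorem norm_avg_le {V : Type} [NormedAddCommGroup V] [NormedSpace ℝ V] (F : List (Fin n) → V) :
    ‖avg n N F‖ ≤ avg n N fun l => ‖F l‖ := by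
  unfold avg
  rw [norm_smul, Real.norm_of_nonneg (by positivity), smul_eq_mul]
  gcongr
  exact norm_sum_le _ _

theorem abs_avg_le (F : List (Fin n) → ℝ) : |avg n N F| ≤ avg n N fun l => |F l| :=
  norm_avg_le F

theorem avg_abs_le_sqrt (hn : n ≠ 0) (F : List (Fin n) → ℝ) :
    avg n N (fun l => |F l|) ≤ √(avg n N fun l => F l ^ 2) := by
  apply Real.le_sqrt_of_sq_le
  set c := avg n N fun l => |F l|
  have h : 0 ≤ avg n N fun l => (|F l| - c) ^ 2 := avg_nonneg fun l => sq_nonneg _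
  have h2 : (avg n N fun l => (|F l| - c) ^ 2) = avg n N (fun l => F l ^ 2) - c ^ 2 := by
    have : ∀ l, (|F l| - c) ^ 2 = (F l ^ 2 - (2 * c) * |F l|) + c ^ 2 := fun l => by
      rw [sub_sq, sq_abs]; ring
    simp only [this]
    rw [avg_add, avg_sub, avg_mul_left, avg_const hn]
    ring
  linarith

end avg

/-! ### Moments of additive functionals of a uniform word. -/

section cumul

variable {n N : ℕ}

/-- The sum of `h j l` over all decompositions of a word as `_ ++ j :: l`: the additive functional
of the word, read from right to left, with increments `h`. -/
def cumul (h : Fin n → List (Fin n) → ℝ) : List (Fin n) → ℝ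
  | [] => 0
  | j :: l => cumul h l + h j l

theorem avg_cumul (h : Fin n → List (Fin n) → ℝ) (hn : n ≠ 0) :
    avg n N (cumul h) =
      ∑ m ∈ Finset.range N, avg n m fun l => (n : ℝ)⁻¹ * ∑ j, h j l := by
  induction N with
  | zero => simp [avg_zero, cumul]
  | succ N ih =>
    rw [avg_succ, Finset.sum_range_succ, ← ih, ← avg_add]
    refine avg_congr fun l _ => ?_
    simp only [cumul, Finset.sum_add_distrib, smul_eq_mul, mul_add]
    simp [hn]

/-- Orthogonality of martingale increments: by `hm` the cross term vanishes when the newest letter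
is averaged. -/
theorem avg_cumul_sq (h : Fin n → List (Fin n) → ℝ) (hn : n ≠ 0)
    (hm : ∀ l, ∑ j, h j l = 0) :
    avg n N (fun l => cumul h l ^ 2) =
      ∑ m ∈ Finset.range N, avg n m fun l => (n : ℝ)⁻¹ * ∑ j, h j l ^ 2 := by
  induction N with
  | zero => simp [avg_zero, cumul]
  | succ N ih =>
    rw [avg_succ, Finset.sum_range_succ, ← ih, ← avg_add]
    refine avg_congr fun l _ => ?_
    have : ∀ j, cumul h (j :: l) ^ 2 = cumul h l ^ 2 + 2 * cumul h l * h j l + h j l ^ 2 :=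
      fun j => by simp only [cumul]; ring
    simp only [this, Finset.sum_add_distrib, smul_eq_mul, ← Finset.mul_sum, hm]
    simp [hn, mul_add]

theorem cumul_add (g h : Fin n → List (Fin n) → ℝ) (l : List (Fin n)) :
    cumul (fun j l => g j l + h j l) l = cumul g l + cumul h l := by
  induction l with
  | nil => simp [cumul]
  | cons j l ih => simp only [cumul, ih]; ring

theorem cumul_const_mul (c : ℝ) (h : Fin n → List (Fin n) → ℝ) (l : List (Fin n)) :
    cumul (fun j l => c * h j l) l = c * cumul h l := by
  induction l with
  | nil => simp [cumul]
  | cons j l ih => simp only [cumul, ih]; ring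

theorem cumul_length (g : ℕ → ℝ) (l : List (Fin n)) :
    cumul (fun _ l => g l.length) l = ∑ m ∈ Finset.range l.length, g m := by
  induction l with
  | nil => simp [cumul]
  | cons j l ih => simp only [cumul, ih, List.length_cons, Finset.sum_range_succ]

theorem cumul_nonneg {h : Fin n → List (Fin n) → ℝ} (h0 : ∀ j l, 0 ≤ h j l)
    (l : List (Fin n)) : 0 ≤ cumul h l := by
  induction l with
  | nil => simp [cumul]
  | cons j l ih => simp only [cumul]; linarith [h0 j l]

theorem abs_cumul_le (h : Fin n → List (Fin n) → ℝ) (l : List (Fin n)) :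
    |cumul h l| ≤ cumul (fun j l => |h j l|) l := by
  induction l with
  | nil => simp [cumul]
  | cons j l ih => simp only [cumul]; exact (abs_add_le _ _).trans (by linarith)

/-- Sum of the `p`-th powers of the numbers of previous occurrences of each letter. -/
def psum (p : ℕ) (l : List (Fin n)) : ℝ := cumul (fun j l => (l.count j : ℝ) ^ p) l

theorem psum_nil (p : ℕ) : psum p ([] : List (Fin n)) = 0 := rfl

theorem psum_cons (p : ℕ) (j : Fin n) (l : List (Fin n)) :
    psum p (j :: l) = psum p l + (l.count j : ℝ) ^ p := rfl

theorem psum_nonneg (p : ℕ) (l : List (Fin n)) : 0 ≤ psum p l :=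
  cumul_nonneg (fun _ _ => by positivity) l

theorem sum_count (l : List (Fin n)) : ∑ j, (l.count j : ℝ) = l.length := by
  induction l with
  | nil => simp
  | cons a l ih =>
    simp only [List.count_cons, Nat.cast_add, Finset.sum_add_distrib, ih, List.length_cons]
    simp

/-- A letter occurring `c` times contributes `0 + 1 + ⋯ + (c - 1)` to `psum 1`, and `c² = c + 2 (c
choose 2)`. This expresses the compensator of `psum 2` through `psum 1`. -/
theorem sum_count_sq (l : List (Fin n)) :
    ∑ j, (l.count j : ℝ) ^ 2 = l.length + 2 * psum 1 l := by
  induction l with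
  | nil => simp [psum_nil]
  | cons a l ih =>
    have : ∀ j, (((a :: l).count j : ℕ) : ℝ) ^ 2 =
        (l.count j : ℝ) ^ 2 + if a = j then 2 * (l.count j : ℝ) + 1 else 0 := fun j => by
      rw [List.count_cons]
      by_cases h : a = j
      · simp [h]; ring
      · simp [h]
    simp only [this, Finset.sum_add_distrib, ih, List.length_cons, psum_cons]
    simp
    ring

/-- `∑_{m < N} (m / n) ^ p`. -/
def msum (n p N : ℕ) : ℝ := ∑ m ∈ Finset.range N, ((m : ℝ) / n) ^ p

/-- The centred number of pairs of equal letters. -/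
def centred (l : List (Fin n)) : ℝ := psum 1 l - msum n 1 l.length

/-- The mean of `psum 2` over words of length `N`. -/
def mean₂ (n N : ℕ) : ℝ := ∑ m ∈ Finset.range N, ((m : ℝ) / n + 2 / n * msum n 1 m)

/-- The counts sum to the length, so the increments have mean zero over `j`: `centred` is a
martingale. -/
theorem centred_eq_cumul (l : List (Fin n)) :
    centred l = cumul (fun j l => (l.count j : ℝ) - (l.length : ℝ) / n) l := by
  induction l with
  | nil => simp [centred, cumul, psum_nil, msum]
  | cons j l ih =>
    rw [cumul, ← ih]
    simp only [centred, psum_cons, List.length_cons, msum, Finset.sum_range_succ, pow_one]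
    ring

/-- A new letter multiplies a single term of the sum by `e`, hence the sum by `1 + (e - 1) / n` on
average. -/
theorem avg_sum_exp_count (hn : n ≠ 0) :
    avg n N (fun l => (n : ℝ)⁻¹ * ∑ j, Real.exp (l.count j)) =
      (1 + (Real.exp 1 - 1) / n) ^ N := by
  have hn' : (n : ℝ) ≠ 0 := by exact_mod_cast hn
  induction N with
  | zero => simp [avg_zero, hn]
  | succ N ih =>
    rw [avg_succ, pow_succ, ← ih, mul_comm, ← avg_mul_left]
    refine avg_congr fun l _ => ?_
    have h1 : ∀ a j : Fin n, Real.exp (((a :: l).count j : ℕ) : ℝ) =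
        Real.exp (l.count j) + if a = j then (Real.exp 1 - 1) * Real.exp (l.count j) else 0 := by
      intro a j
      rw [List.count_cons]
      by_cases h : a = j
      · simp [h, Real.exp_add]; ring
      · simp [h]
    simp only [h1, Finset.sum_add_distrib, Finset.sum_ite_eq, Finset.mem_univ, if_true,
      ← Finset.mul_sum, smul_eq_mul, Finset.sum_const, Finset.card_univ, Fintype.card_fin,
      nsmul_eq_mul]
    field_simp

/-- Uses `x ^ p ≤ p! exp x` and the exponential moment, with `e - 1 ≤ 2`. -/
theorem avg_sum_count_pow_le (hn : n ≠ 0) (p : ℕ) {c : ℝ} (hN : (N : ℝ) ≤ c * n) :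
    avg n N (fun l => (n : ℝ)⁻¹ * ∑ j, (l.count j : ℝ) ^ p) ≤
      p.factorial * Real.exp (2 * c) := by
  have hn' : (0 : ℝ) < n := by exact_mod_cast Nat.pos_of_ne_zero hn
  calc _ ≤ avg n N (fun l => p.factorial * ((n : ℝ)⁻¹ * ∑ j, Real.exp (l.count j))) := by
        refine avg_mono fun l _ => ?_
        rw [mul_left_comm, Finset.mul_sum _ _ (p.factorial : ℝ)]
        refine mul_le_mul_of_nonneg_left (Finset.sum_le_sum fun j _ => ?_) (by positivity)
        have := Real.pow_div_factorial_le_exp (l.count j : ℝ) (by positivity) p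
        rwa [div_le_iff₀' (by positivity)] at this
    _ = p.factorial * (1 + (Real.exp 1 - 1) / n) ^ N := by rw [avg_mul_left, avg_sum_exp_count hn]
    _ ≤ p.factorial * Real.exp (2 * c) := by
        gcongr
        have h1 : 1 + (Real.exp 1 - 1) / n ≤ Real.exp (2 / n) := by
          have := Real.add_one_le_exp (2 / (n : ℝ))
          have h2 : (Real.exp 1 - 1) / n ≤ 2 / n := by
            gcongr; linarith [Real.exp_one_lt_d9]
          linarith
        have h0 : 0 ≤ 1 + (Real.exp 1 - 1) / n := by
          have : 0 ≤ Real.exp 1 - 1 := by linarith [Real.exp_one_gt_d9]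
          positivity
        calc _ ≤ Real.exp (2 / n) ^ N := by gcongr
          _ = Real.exp (N * (2 / n)) := by rw [← Real.exp_nat_mul]
          _ ≤ _ := by
            rw [Real.exp_le_exp, mul_div_assoc', div_le_iff₀ hn']; linarith

theorem sum_avg_count_pow_le (hn : n ≠ 0) (p : ℕ) {c : ℝ} (hN : (N : ℝ) ≤ c * n) :
    ∑ m ∈ Finset.range N, avg n m (fun l => (n : ℝ)⁻¹ * ∑ j, (l.count j : ℝ) ^ p) ≤
      c * n * (p.factorial * Real.exp (2 * c)) := by
  calc _ ≤ ∑ m ∈ Finset.range N, p.factorial * Real.exp (2 * c) := by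
        refine Finset.sum_le_sum fun m hm => avg_sum_count_pow_le hn p ?_
        have : (m : ℝ) ≤ N := by exact_mod_cast (Finset.mem_range.1 hm).le
        linarith
    _ = N * (p.factorial * Real.exp (2 * c)) := by simp
    _ ≤ _ := by gcongr

theorem avg_psum_le (hn : n ≠ 0) (p : ℕ) {c : ℝ} (hN : (N : ℝ) ≤ c * n) :
    avg n N (psum p) ≤ c * n * (p.factorial * Real.exp (2 * c)) := by
  change avg n N (cumul _) ≤ _
  rw [avg_cumul _ hn]
  exact sum_avg_count_pow_le hn p hN

theorem sum_sub_mean_sq_le (hn : n ≠ 0) (x : Fin n → ℝ) :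
    ∑ j, (x j - (n : ℝ)⁻¹ * ∑ i, x i) ^ 2 ≤ ∑ j, x j ^ 2 := by
  have hn' : (0 : ℝ) < n := by exact_mod_cast Nat.pos_of_ne_zero hn
  set s := ∑ i, x i
  have : ∀ j, (x j - (n : ℝ)⁻¹ * s) ^ 2 = x j ^ 2 - 2 * (n : ℝ)⁻¹ * s * x j + ((n : ℝ)⁻¹ * s) ^ 2 :=
    fun j => by ring
  simp only [this, Finset.sum_add_distrib, Finset.sum_sub_distrib, ← Finset.mul_sum]
  have h2 : (n : ℝ) * ((n : ℝ)⁻¹ * s) ^ 2 = (n : ℝ)⁻¹ * s * s := by field_simp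
  have h3 : 0 ≤ (n : ℝ)⁻¹ * s * s := by
    rw [mul_assoc]; exact mul_nonneg (by positivity) (mul_self_nonneg s)
  simp only [Finset.sum_const, Finset.card_univ, Fintype.card_fin, nsmul_eq_mul, h2]
  linarith

theorem sum_sub_mean (hn : n ≠ 0) (x : Fin n → ℝ) :
    ∑ j, (x j - (n : ℝ)⁻¹ * ∑ i, x i) = 0 := by
  have hn' : (n : ℝ) ≠ 0 := by exact_mod_cast hn
  simp [hn']

/-- The `L²` bound for a martingale whose increments are centred powers of occurrence counts. -/
theorem avg_abs_cumul_centred_le (hn : n ≠ 0) (p : ℕ) {c : ℝ} (hN : (N : ℝ) ≤ c * n) :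
    avg n N (fun l => |cumul (fun j l => (l.count j : ℝ) ^ p -
      (n : ℝ)⁻¹ * ∑ i, (l.count i : ℝ) ^ p) l|) ≤
      √(c * n * ((p * 2).factorial * Real.exp (2 * c))) := by
  refine (avg_abs_le_sqrt hn _).trans (Real.sqrt_le_sqrt ?_)
  rw [avg_cumul_sq _ hn fun l => sum_sub_mean hn _]
  refine le_trans (Finset.sum_le_sum fun m _ => avg_mono fun l _ => ?_)
    (sum_avg_count_pow_le hn (p * 2) hN)
  refine mul_le_mul_of_nonneg_left ?_ (by positivity)
  simpa only [pow_mul] using sum_sub_mean_sq_le hn fun j => (l.count j : ℝ) ^ p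

theorem avg_abs_centred_le (hn : n ≠ 0) {c : ℝ} (hN : (N : ℝ) ≤ c * n) :
    avg n N (fun l => |centred l|) ≤ √(c * n * (2 * Real.exp (2 * c))) := by
  have := avg_abs_cumul_centred_le hn 1 hN
  simp only [pow_one, sum_count] at this
  simpa [centred_eq_cumul, div_eq_inv_mul, Nat.factorial] using this

/-- Doob decomposition. The compensator increment of `psum 2` is `m / n + (2 / n) psum 1`; writing
`psum 1 = msum n 1 m + centred` splits it into the deterministic `mean₂` and a small random drift.
-/
theorem psum_two_eq (l : List (Fin n)) :
    psum 2 l = cumul (fun j l => (l.count j : ℝ) ^ 2 -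
      (n : ℝ)⁻¹ * ∑ i, (l.count i : ℝ) ^ 2) l + mean₂ n l.length +
      2 / n * cumul (fun _ l => centred l) l := by
  rw [mean₂, ← cumul_length (fun m => (m : ℝ) / n + 2 / n * msum n 1 m), ← cumul_const_mul,
    ← cumul_add, ← cumul_add]
  unfold psum
  congr 1
  funext j l
  rw [sum_count_sq, centred]
  ring

/-- Both random parts are of order `√n`: the martingale by its L² bound, and the drift because it is
`2 / n` times at most `c n` terms of order `√n`. -/
theorem avg_abs_psum_two_sub_le (hn : n ≠ 0) {c : ℝ} (hc : 0 ≤ c) (hN : (N : ℝ) ≤ c * n) :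
    avg n N (fun l => |psum 2 l - mean₂ n N|) ≤
      √(c * n * (24 * Real.exp (2 * c))) + 2 * c * √(c * n * (2 * Real.exp (2 * c))) := by
  have hn' : (0 : ℝ) < n := by exact_mod_cast Nat.pos_of_ne_zero hn
  have h1 := avg_abs_cumul_centred_le hn 2 hN
  have h2 : avg n N (cumul fun _ l => |centred l|) ≤ c * n * √(c * n * (2 * Real.exp (2 * c))) := by
    rw [avg_cumul _ hn]
    calc _ ≤ ∑ m ∈ Finset.range N, √(c * n * (2 * Real.exp (2 * c))) := by
          refine Finset.sum_le_sum fun m hm => ?_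
          have : (m : ℝ) ≤ N := by exact_mod_cast (Finset.mem_range.1 hm).le
          refine le_trans (le_of_eq ?_) (avg_abs_centred_le hn (this.trans hN))
          refine avg_congr fun l _ => ?_
          simp [hn'.ne']
      _ ≤ _ := by
          rw [Finset.sum_const, nsmul_eq_mul, Finset.card_range]
          gcongr
  calc _ ≤ avg n N (fun l => |cumul (fun j l => (l.count j : ℝ) ^ 2 -
            (n : ℝ)⁻¹ * ∑ i, (l.count i : ℝ) ^ 2) l| +
            2 / n * cumul (fun _ l => |centred l|) l) := by
        refine avg_mono fun l hl => ?_
        rw [psum_two_eq, hl, add_sub_right_comm, add_sub_cancel_right]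
        refine (abs_add_le _ _).trans ?_
        rw [abs_mul, abs_of_pos (show (0 : ℝ) < 2 / n by positivity)]
        gcongr
        exact abs_cumul_le _ _
    _ ≤ √(c * n * (24 * Real.exp (2 * c))) + 2 / n * (c * n * √(c * n * (2 * Real.exp (2 * c)))) := by
        rw [avg_add, avg_mul_left]
        gcongr
        simpa [Nat.factorial] using h1
    _ = _ := by field_simp

theorem msum_one (hn : n ≠ 0) : msum n 1 N = N * (N - 1) / (2 * n) := by
  have hn' : (n : ℝ) ≠ 0 := by exact_mod_cast hn
  induction N with
  | zero => simp [msum]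
  | succ N ih =>
    rw [msum, Finset.sum_range_succ, ← msum, ih]
    push_cast
    field_simp
    ring

/-- At `N = n k` this is `k² n / 2 + O(1)`, the source of both the limiting variance and the drift.
-/
theorem mean₂_sub_msum (hn : n ≠ 0) :
    mean₂ n N - msum n 2 N = N * (N - 1) / 2 * (1 / n - 1 / n ^ 2) := by
  have hn' : (n : ℝ) ≠ 0 := by exact_mod_cast hn
  induction N with
  | zero => simp [msum, mean₂]
  | succ N ih =>
    rw [msum, mean₂, Finset.sum_range_succ, Finset.sum_range_succ, ← msum, ← mean₂,
      add_sub_add_comm, ih, msum_one hn]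
    push_cast
    field_simp
    ring

theorem msum_nonneg (n p N : ℕ) : 0 ≤ msum n p N := Finset.sum_nonneg fun _ _ => by positivity

theorem msum_le (hn : n ≠ 0) (p : ℕ) {c : ℝ} (hN : (N : ℝ) ≤ c * n) :
    msum n p N ≤ c * n * c ^ p := by
  have hn' : (0 : ℝ) < n := by exact_mod_cast Nat.pos_of_ne_zero hn
  have hc : 0 ≤ c := by
    by_contra h
    have : c * n < 0 := mul_neg_of_neg_of_pos (not_le.1 h) hn'
    linarith [Nat.cast_nonneg (α := ℝ) N]
  calc msum n p N ≤ ∑ m ∈ Finset.range N, c ^ p := by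
        refine Finset.sum_le_sum fun m hm => ?_
        have : (m : ℝ) ≤ N := by exact_mod_cast (Finset.mem_range.1 hm).le
        gcongr
        rw [div_le_iff₀ hn']; linarith
    _ = N * c ^ p := by simp
    _ ≤ _ := by gcongr

end cumul

/-- The moment bounds for words of length `n * k` in `n` letters, with `k` fixed. -/
theorem exists_moment_bounds (k : ℕ) : ∃ C : ℝ, 1 ≤ C ∧ ∀ n : ℕ, n ≠ 0 →
    avg n (n * k) (fun l => |centred l|) ≤ C * √n ∧
    avg n (n * k) (fun l => |psum 2 l - mean₂ n (n * k)|) ≤ C * √n ∧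
    avg n (n * k) (psum 3) ≤ C * n ∧
    msum n 2 (n * k) ≤ C * n ∧ msum n 3 (n * k) ≤ C * n ∧
    |mean₂ n (n * k) - msum n 2 (n * k) - (k : ℝ) ^ 2 / 2 * n| ≤ C := by
  set c : ℝ := (k : ℝ)
  have hc : 0 ≤ c := Nat.cast_nonneg k
  set A := √(c * (2 * Real.exp (2 * c)))
  set B := √(c * (24 * Real.exp (2 * c))) + 2 * c * √(c * (2 * Real.exp (2 * c)))
  refine ⟨1 + A + B + c * (6 * Real.exp (2 * c)) + c * c ^ 2 + c * c ^ 3 + (c ^ 2 + c), ?_, ?_⟩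
  · have : 0 ≤ A := by positivity
    have : 0 ≤ B := by positivity
    have : 0 ≤ c * (6 * Real.exp (2 * c)) + c * c ^ 2 + c * c ^ 3 + (c ^ 2 + c) := by positivity
    linarith
  intro n hn
  have hn' : (1 : ℝ) ≤ n := by exact_mod_cast Nat.pos_of_ne_zero hn
  have hs : 0 ≤ √(n : ℝ) := by positivity
  have hN : ((n * k : ℕ) : ℝ) ≤ c * n := by push_cast; rw [mul_comm]
  have hA : 0 ≤ A := by positivity
  have hB : 0 ≤ B := by positivity
  have p1 : 0 ≤ c * (6 * Real.exp (2 * c)) := by positivity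
  have p2 : 0 ≤ c * c ^ 2 := by positivity
  have p3 : 0 ≤ c * c ^ 3 := by positivity
  have p4 : 0 ≤ c ^ 2 + c := by positivity
  have hsq : ∀ y : ℝ, √(c * n * y) = √(c * y) * √n := fun y => by
    rw [← Real.sqrt_mul' _ (by positivity)]; congr 1; ring
  refine ⟨?_, ?_, ?_, ?_, ?_, ?_⟩
  · refine (avg_abs_centred_le hn hN).trans ?_
    rw [hsq]
    exact mul_le_mul_of_nonneg_right (by linarith) hs
  · refine (avg_abs_psum_two_sub_le hn hc hN).trans ?_
    rw [hsq, hsq, ← mul_assoc (2 * c), ← add_mul]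
    exact mul_le_mul_of_nonneg_right (by linarith) hs
  · refine (avg_psum_le hn 3 hN).trans ?_
    rw [mul_right_comm]
    refine mul_le_mul_of_nonneg_right ?_ (by linarith)
    norm_num [Nat.factorial]
    linarith
  · refine (msum_le hn 2 hN).trans ?_
    rw [mul_right_comm]
    exact mul_le_mul_of_nonneg_right (by linarith) (by linarith)
  · refine (msum_le hn 3 hN).trans ?_
    rw [mul_right_comm]
    exact mul_le_mul_of_nonneg_right (by linarith) (by linarith)
  · rw [mean₂_sub_msum hn]
    have : ((n * k : ℕ) : ℝ) * ((n * k : ℕ) - 1) / 2 * (1 / n - 1 / n ^ 2) - c ^ 2 / 2 * n =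
        -(c ^ 2 / 2) - c / 2 + c / 2 * (1 / n) := by
      push_cast
      change (n * c) * (n * c - 1) / 2 * (1 / n - 1 / n ^ 2) - c ^ 2 / 2 * n = _
      field_simp
      ring
    rw [this]
    have h1 : 1 / (n : ℝ) ≤ 1 := by rw [div_le_one (by linarith)]; exact hn'
    have h0 : 0 ≤ 1 / (n : ℝ) := by positivity
    have h2 : c / 2 * (1 / n) ≤ c / 2 := by nlinarith
    have h3 : 0 ≤ c / 2 * (1 / n) := by positivity
    rw [abs_le]
    constructor <;> nlinarith

/-! ### Comparison of `1 + i x` with `exp (i x + x² / 2)`. -/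

open Complex in
-- The derivative collapses to `-i t² exp (-i t - t² / 2)`, of modulus at most `x²` on `[-|x|,
-- |x|]`; the mean value inequality then gives the cube.
theorem norm_one_add_mul_I_mul_exp_sub_one_le (x : ℝ) :
    ‖(1 + x * I) * cexp (-(x * I) - x ^ 2 / 2) - 1‖ ≤ |x| ^ 3 := by
  have hd : ∀ t ∈ Set.Icc (-|x|) |x|, HasDerivWithinAt
      (fun t : ℝ => (1 + t * I) * cexp (-(t * I) - t ^ 2 / 2))
      (-I * t ^ 2 * cexp (-(t * I) - t ^ 2 / 2)) (Set.Icc (-|x|) |x|) t := by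
    intro t _
    have h1 : HasDerivAt (fun t : ℝ => (t : ℂ)) 1 t := Complex.ofRealCLM.hasDerivAt
    have h2 := ((h1.mul_const I).const_add 1).mul
      (((h1.mul_const I).neg.sub ((h1.pow 2).div_const 2)).cexp)
    refine (h2.congr_deriv ?_).hasDerivWithinAt
    simp only [Pi.pow_apply, Pi.sub_apply, Pi.neg_apply]
    push_cast
    ring_nf
    rw [I_sq]
    ring
  have hb : ∀ t ∈ Set.Icc (-|x|) |x|,
      ‖-I * (t : ℂ) ^ 2 * cexp (-(t * I) - t ^ 2 / 2)‖ ≤ |x| ^ 2 := by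
    intro t ht
    have ht' : |t| ≤ |x| := abs_le.2 ht
    rw [norm_mul, norm_mul, norm_neg, norm_I, one_mul, norm_pow, Complex.norm_real, norm_exp]
    have : (-((t : ℂ) * I) - (t : ℂ) ^ 2 / 2).re = -(t ^ 2 / 2) := by
      simp [← ofReal_pow]
    rw [this, Real.norm_eq_abs]
    calc |t| ^ 2 * Real.exp (-(t ^ 2 / 2)) ≤ |t| ^ 2 * 1 := by
          gcongr
          rw [Real.exp_le_one_iff]
          nlinarith [sq_nonneg t]
      _ ≤ _ := by rw [mul_one]; gcongr
  have := Convex.norm_image_sub_le_of_norm_hasDerivWithin_le hd hb (convex_Icc _ _)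
    (x := 0) (y := x) ⟨by simp, by simp⟩ ⟨neg_abs_le x, le_abs_self x⟩
  simpa [pow_succ] using this

open Complex in
theorem norm_one_add_mul_I_sub_exp_le (x : ℝ) :
    ‖(1 + x * I) - cexp (x * I + x ^ 2 / 2)‖ ≤ Real.exp (x ^ 2 / 2) * |x| ^ 3 := by
  have h1 : (1 + x * I) - cexp (x * I + x ^ 2 / 2) =
      cexp (x * I + x ^ 2 / 2) * ((1 + x * I) * cexp (-(x * I) - x ^ 2 / 2) - 1) := by
    have : cexp (x * I + x ^ 2 / 2) * cexp (-(x * I) - x ^ 2 / 2) = 1 := by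
      rw [← Complex.exp_add]; simp
    linear_combination -(1 + x * I) * this
  rw [h1, norm_mul, norm_exp]
  have : ((x : ℂ) * I + (x : ℂ) ^ 2 / 2).re = x ^ 2 / 2 := by simp [← ofReal_pow]
  rw [this]
  gcongr
  exact norm_one_add_mul_I_mul_exp_sub_one_le x

open Complex in
theorem norm_one_add_mul_I_sq (x : ℝ) : ‖1 + (x : ℂ) * I‖ ^ 2 = 1 + x ^ 2 := by
  rw [Complex.sq_norm, Complex.normSq_apply]
  simp
  ring

open Complex in
theorem norm_one_add_mul_I_le (x : ℝ) : ‖1 + (x : ℂ) * I‖ ≤ Real.exp (x ^ 2 / 2) := by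
  refine le_of_sq_le_sq ?_ (Real.exp_pos _).le
  rw [norm_one_add_mul_I_sq, ← Real.exp_nat_mul]
  refine (add_comm _ _).trans_le ((Real.add_one_le_exp _).trans (le_of_eq ?_))
  congr 1; push_cast; ring

open Complex in
theorem one_le_norm_one_add_mul_I (x : ℝ) : 1 ≤ ‖1 + (x : ℂ) * I‖ := by
  refine le_of_sq_le_sq ?_ (norm_nonneg _)
  rw [norm_one_add_mul_I_sq]
  nlinarith [sq_nonneg x]

open Complex in
-- Induction step for both products below. Measuring the error relative to `exp (s / 2)`, the
-- modulus of the approximant, makes the cubic errors simply add up.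
theorem norm_mul_one_add_mul_I_sub_exp_le {P : ℂ} {w s r x : ℝ}
    (h : ‖P - cexp (w * I + (s / 2 : ℝ))‖ ≤ Real.exp (s / 2) * r) :
    ‖P * (1 + x * I) - cexp ((w + x : ℝ) * I + ((s + x ^ 2) / 2 : ℝ))‖ ≤
      Real.exp ((s + x ^ 2) / 2) * (r + |x| ^ 3) := by
  set Z := cexp (w * I + (s / 2 : ℝ))
  have hZ : ‖Z‖ = Real.exp (s / 2) := by simp [Z, norm_exp]
  have h1 : P * (1 + x * I) - cexp ((w + x : ℝ) * I + ((s + x ^ 2) / 2 : ℝ)) =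
      (P - Z) * (1 + x * I) + Z * ((1 + x * I) - cexp (x * I + x ^ 2 / 2)) := by
    have : cexp ((w + x : ℝ) * I + ((s + x ^ 2) / 2 : ℝ)) = Z * cexp (x * I + x ^ 2 / 2) := by
      rw [← Complex.exp_add]; congr 1; push_cast; ring
    rw [this]; ring
  rw [h1, add_div, Real.exp_add]
  refine (norm_add_le _ _).trans ?_
  rw [norm_mul, norm_mul, hZ]
  have h2 := mul_le_mul h (norm_one_add_mul_I_le x) (norm_nonneg _) ((norm_nonneg _).trans h)
  have h3 := mul_le_mul_of_nonneg_left (norm_one_add_mul_I_sub_exp_le x)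
    (Real.exp_pos (s / 2)).le
  calc _ ≤ _ := add_le_add h2 h3
    _ = _ := by ring

/-! ### The product martingale. -/

section products

variable {n : ℕ}

/-- The product of `1 + i ε x` over the numbers `x` of previous occurrences. -/
def wordProd (ε : ℝ) : List (Fin n) → ℂ
  | [] => 1
  | j :: l => wordProd ε l * (1 + (ε * l.count j : ℝ) * Complex.I)

/-- The mean of `wordProd` over the words of length `N`. -/
def meanProd (n : ℕ) (ε : ℝ) : ℕ → ℂ
  | 0 => 1
  | N + 1 => meanProd n ε N * (1 + (ε * (N / n) : ℝ) * Complex.I)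

/-- The normalized `wordProd`, stopped once `psum 2` exceeds `b`. -/
def stoppedProd (ε b : ℝ) : List (Fin n) → ℂ
  | [] => 1
  | j :: l => stoppedProd ε b l * if psum 2 l ≤ b then
      (1 + (ε * l.count j : ℝ) * Complex.I) / (1 + (ε * (l.length / n) : ℝ) * Complex.I) else 1

theorem norm_wordProd_sub_le (ε : ℝ) (l : List (Fin n)) :
    ‖wordProd ε l - Complex.exp ((ε * psum 1 l : ℝ) * Complex.I + (ε ^ 2 * psum 2 l / 2 : ℝ))‖ ≤
      Real.exp (ε ^ 2 * psum 2 l / 2) * (|ε| ^ 3 * psum 3 l) := by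
  induction l with
  | nil => simp [wordProd, psum_nil]
  | cons j l ih =>
    have := norm_mul_one_add_mul_I_sub_exp_le (x := ε * l.count j) ih
    rw [abs_mul, Nat.abs_cast, mul_pow, mul_pow, ← mul_add, ← mul_add] at this
    simp only [wordProd, psum_cons, pow_one, mul_add] at this ⊢
    exact this

theorem norm_meanProd_sub_le (ε : ℝ) (N : ℕ) :
    ‖meanProd n ε N -
      Complex.exp ((ε * msum n 1 N : ℝ) * Complex.I + (ε ^ 2 * msum n 2 N / 2 : ℝ))‖ ≤
      Real.exp (ε ^ 2 * msum n 2 N / 2) * (|ε| ^ 3 * msum n 3 N) := by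
  induction N with
  | zero => simp [meanProd, msum]
  | succ N ih =>
    have := norm_mul_one_add_mul_I_sub_exp_le (x := ε * (N / n)) ih
    rw [abs_mul, abs_of_nonneg (show (0 : ℝ) ≤ N / n by positivity), mul_pow, mul_pow, ← mul_add,
      ← mul_add] at this
    simp only [msum, Finset.sum_range_succ] at this ⊢
    simp only [meanProd, pow_one, mul_add] at this ⊢
    exact this

theorem one_le_norm_meanProd (ε : ℝ) (N : ℕ) : 1 ≤ ‖meanProd n ε N‖ := by
  induction N with
  | zero => simp [meanProd]
  | succ N ih =>
    rw [meanProd, norm_mul]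
    exact one_le_mul_of_one_le_of_one_le ih (one_le_norm_one_add_mul_I _)

/-- Averaged over the new letter, the factor is one, because the counts sum to the length. The
stopping test sees only the past, so it preserves the martingale property. -/
theorem avg_stoppedProd (hn : n ≠ 0) (ε b : ℝ) (N : ℕ) :
    avg n N (stoppedProd ε b) = 1 := by
  have hn' : (n : ℂ) ≠ 0 := by exact_mod_cast hn
  induction N with
  | zero => simp [avg_zero, stoppedProd]
  | succ N ih =>
    rw [avg_succ, ← ih]
    refine avg_congr fun l _ => ?_
    simp only [stoppedProd, ← Finset.mul_sum]
    by_cases h : psum 2 l ≤ b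
    · have h0 : (1 + (ε * (l.length / n) : ℝ) * Complex.I : ℂ) ≠ 0 := by
        rw [← norm_pos_iff]
        exact one_pos.trans_le (one_le_norm_one_add_mul_I _)
      have hs : ∑ j, (1 + (ε * l.count j : ℝ) * Complex.I : ℂ) =
          n * (1 + (ε * (l.length / n) : ℝ) * Complex.I) := by
        have : ((l.length : ℝ) : ℂ) = ∑ j, ((l.count j : ℝ) : ℂ) := by
          rw [← sum_count l]; push_cast; rfl
        push_cast at this ⊢
        rw [this]
        simp only [Finset.sum_add_distrib, ← Finset.sum_mul, ← Finset.mul_sum]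
        simp
        field_simp
      simp only [h, if_true, ← Finset.sum_div, hs]
      rw [mul_div_cancel_right₀ _ h0, Complex.real_smul]
      push_cast
      field_simp
    · simp only [h, if_false, Complex.real_smul]
      simp
      field_simp

theorem stoppedProd_eq (ε b : ℝ) {l : List (Fin n)} (h : psum 2 l ≤ b) :
    stoppedProd ε b l = wordProd ε l / meanProd n ε l.length := by
  induction l with
  | nil => simp [stoppedProd, wordProd, meanProd]
  | cons j l ih =>
    have h' : psum 2 l ≤ b := by
      rw [psum_cons] at h
      nlinarith [sq_nonneg (l.count j : ℝ)]
    rw [stoppedProd, ih h', if_pos h', wordProd, List.length_cons, meanProd, div_mul_div_comm]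

/-- The latest occurrence of a letter already put `(c - 1)²` into `psum 2`, and `c² ≤ 2 (c - 1)² +
2`. This bounds the overshoot of `psum 2` at the stopping time by `2 b + 2`. -/
theorem count_sq_le (j : Fin n) (l : List (Fin n)) :
    (l.count j : ℝ) ^ 2 ≤ 2 * psum 2 l + 2 := by
  induction l with
  | nil => simp [psum_nil]
  | cons a l ih =>
    rw [psum_cons, List.count_cons]
    by_cases h : a = j
    · subst h
      simp only [beq_self_eq_true, if_true, Nat.cast_add, Nat.cast_one]
      nlinarith [psum_nonneg 2 l, sq_nonneg ((l.count a : ℝ) - 1)]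
    · simp [h]
      nlinarith [sq_nonneg (l.count a : ℝ)]

theorem norm_stoppedProd_le (ε : ℝ) {b : ℝ} (hb : 0 ≤ b) (l : List (Fin n)) :
    ‖stoppedProd ε b l‖ ≤ Real.exp (ε ^ 2 * (3 * b + 2) / 2) := by
  -- The exponent must follow `psum 2` while the product runs and be frozen after stopping; the cap
  -- `3 b + 2` is the level `b` plus the overshoot.
  suffices h : ‖stoppedProd ε b l‖ ≤ Real.exp (ε ^ 2 * min (psum 2 l) (3 * b + 2) / 2) by
    refine h.trans ?_
    gcongr
    exact min_le_right _ _
  induction l with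
  | nil =>
    have : min (psum 2 ([] : List (Fin n))) (3 * b + 2) = 0 := by
      rw [psum_nil, min_eq_left]; positivity
    simp [stoppedProd, this]
  | cons j l ih =>
    have hmono : psum 2 l ≤ psum 2 (j :: l) := by
      rw [psum_cons]; nlinarith [sq_nonneg (l.count j : ℝ)]
    rw [stoppedProd, norm_mul]
    by_cases h : psum 2 l ≤ b
    · have h1 : min (psum 2 (j :: l)) (3 * b + 2) = psum 2 l + (l.count j : ℝ) ^ 2 := by
        rw [psum_cons, min_eq_left]
        linarith [count_sq_le j l]
      have h2 : min (psum 2 l) (3 * b + 2) = psum 2 l := min_eq_left (by linarith)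
      rw [h2] at ih
      rw [h1, if_pos h, norm_div, mul_add, add_div, Real.exp_add, ← mul_pow]
      refine mul_le_mul ih ?_ (by positivity) (by positivity)
      exact (div_le_self (norm_nonneg _) (one_le_norm_one_add_mul_I _)).trans
        (norm_one_add_mul_I_le _)
    · rw [if_neg h, norm_one, mul_one]
      refine ih.trans ?_
      gcongr

theorem abs_exp_sub_exp_le {x y z : ℝ} (hx : x ≤ z) (hy : y ≤ z) :
    |Real.exp x - Real.exp y| ≤ Real.exp z * |x - y| := by
  wlog h : y ≤ x generalizing x y
  · rw [abs_sub_comm, abs_sub_comm x y]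
    exact this hy hx (le_of_not_ge h)
  rw [abs_of_nonneg (by simpa using h), abs_of_nonneg (by linarith)]
  have h1 := Real.add_one_le_exp (y - x)
  have h2 : Real.exp y = Real.exp x * Real.exp (y - x) := by rw [← Real.exp_add]; congr 1; ring
  have h3 : Real.exp x ≤ Real.exp z := Real.exp_le_exp.2 hx
  have h4 := Real.exp_pos x
  rw [h2]
  nlinarith

open Complex in
-- Before stopping, the product is `wordProd / meanProd`, both factors have exponential
-- approximations, and replacing `psum 2` by `mean₂` costs the `ε²` term. Otherwise `hμ` forces
-- `|psum 2 - mean₂| ≥ n`, so the `2 / n` term pays for the crude bound, as in Markov's inequality.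
-- The 5 comes from `3 b + 2 ≤ 5 b`.
theorem norm_stoppedProd_sub_exp_le (hn : n ≠ 0) (ε : ℝ) {b : ℝ} {N : ℕ} (hb : 1 ≤ b)
    (hM : msum n 2 N ≤ b) (hμ : mean₂ n N + n ≤ b) (hμ0 : 0 ≤ mean₂ n N)
    {l : List (Fin n)} (hl : l.length = N) :
    ‖stoppedProd ε b l -
        cexp ((ε * centred l : ℝ) * I + (ε ^ 2 * (mean₂ n N - msum n 2 N) / 2 : ℝ))‖ ≤
      Real.exp (5 * (ε ^ 2 * b) / 2) * (|ε| ^ 3 * (psum 3 l + msum n 3 N) +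
        (ε ^ 2 + 2 / n) * |psum 2 l - mean₂ n N|) := by
  have hn' : (0 : ℝ) < n := by exact_mod_cast Nat.pos_of_ne_zero hn
  set H := Real.exp (5 * (ε ^ 2 * b) / 2)
  have hM0 : 0 ≤ msum n 2 N := msum_nonneg _ _ _
  have hM3 : 0 ≤ msum n 3 N := msum_nonneg _ _ _
  have hp3 : 0 ≤ psum 3 l := psum_nonneg _ _
  have hε : 0 ≤ ε ^ 2 := sq_nonneg ε
  have hH : ∀ y : ℝ, y ≤ 5 * b → Real.exp (ε ^ 2 * y / 2) ≤ H := fun y hy => by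
    rw [Real.exp_le_exp]; nlinarith
  by_cases h : psum 2 l ≤ b
  · rw [stoppedProd_eq ε b h, hl]
    set Y := wordProd ε l
    set D := meanProd n ε N
    set Z := cexp ((ε * psum 1 l : ℝ) * I + (ε ^ 2 * psum 2 l / 2 : ℝ))
    set U := cexp ((ε * msum n 1 N : ℝ) * I + (ε ^ 2 * msum n 2 N / 2 : ℝ))
    have hY : ‖Y - Z‖ ≤ _ := norm_wordProd_sub_le ε l
    have hD : ‖D - U‖ ≤ _ := norm_meanProd_sub_le ε N
    have hD1 : 1 ≤ ‖D‖ := one_le_norm_meanProd ε N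
    have hZn : ‖Z‖ = Real.exp (ε ^ 2 * psum 2 l / 2) := by
      rw [norm_exp]; simp only [add_re, mul_re, ofReal_re, ofReal_im, I_re, I_im]; simp
    have hUn : ‖U‖ = Real.exp (ε ^ 2 * msum n 2 N / 2) := by
      rw [norm_exp]; simp only [add_re, mul_re, ofReal_re, ofReal_im, I_re, I_im]; simp
    have hU1 : 1 ≤ ‖U‖ := by rw [hUn]; exact Real.one_le_exp (by positivity)
    have hD0 : D ≠ 0 := norm_pos_iff.1 (by linarith)
    have hU0 : U ≠ 0 := norm_pos_iff.1 (by linarith)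
    have e1 : ‖Y / D - Z / U‖ ≤ H * (|ε| ^ 3 * (psum 3 l + msum n 3 N)) := by
      have : Y / D - Z / U = (Y - Z) / D - Z * (D - U) / (D * U) := by field_simp; ring
      rw [this]
      refine (norm_sub_le _ _).trans ?_
      rw [norm_div, norm_div, norm_mul, norm_mul]
      have i1 : ‖Y - Z‖ / ‖D‖ ≤ H * (|ε| ^ 3 * psum 3 l) := by
        refine (div_le_self (norm_nonneg _) hD1).trans (hY.trans ?_)
        gcongr
        exact hH _ (by linarith)
      have i2 : ‖Z‖ * ‖D - U‖ / (‖D‖ * ‖U‖) ≤ H * (|ε| ^ 3 * msum n 3 N) := by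
        refine (div_le_self (by positivity) (one_le_mul_of_one_le_of_one_le hD1 hU1)).trans ?_
        rw [hZn]
        calc _ ≤ Real.exp (ε ^ 2 * psum 2 l / 2) *
              (Real.exp (ε ^ 2 * msum n 2 N / 2) * (|ε| ^ 3 * msum n 3 N)) := by gcongr
          _ = Real.exp (ε ^ 2 * (psum 2 l + msum n 2 N) / 2) * (|ε| ^ 3 * msum n 3 N) := by
            rw [← mul_assoc, ← Real.exp_add]; congr 2; ring
          _ ≤ _ := by
            gcongr
            exact hH _ (by linarith)
      calc _ ≤ _ := add_le_add i1 i2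
        _ = _ := by ring
    have e2 : ‖Z / U - cexp ((ε * centred l : ℝ) * I +
        (ε ^ 2 * (mean₂ n N - msum n 2 N) / 2 : ℝ))‖ ≤
        H * (ε ^ 2 * |psum 2 l - mean₂ n N|) := by
      have h1 : Z / U = cexp ((ε * centred l : ℝ) * I) *
          (Real.exp (ε ^ 2 * (psum 2 l - msum n 2 N) / 2) : ℝ) := by
        rw [← Complex.exp_sub, ofReal_exp, ← Complex.exp_add, centred, hl]
        congr 1
        push_cast
        ring
      rw [h1, Complex.exp_add, ← ofReal_exp, ← mul_sub, norm_mul, norm_exp_ofReal_mul_I, one_mul,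
        ← ofReal_sub, norm_real, Real.norm_eq_abs]
      refine (abs_exp_sub_exp_le (z := 5 * (ε ^ 2 * b) / 2) (by nlinarith) (by nlinarith)).trans ?_
      change H * _ ≤ _
      gcongr
      rw [show ε ^ 2 * (psum 2 l - msum n 2 N) / 2 - ε ^ 2 * (mean₂ n N - msum n 2 N) / 2 =
        ε ^ 2 / 2 * (psum 2 l - mean₂ n N) by ring, abs_mul, abs_of_nonneg (by positivity)]
      gcongr
      linarith
    calc _ ≤ _ := norm_sub_le_norm_sub_add_norm_sub _ (Z / U) _
      _ ≤ _ := add_le_add e1 e2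
      _ ≤ H * (|ε| ^ 3 * (psum 3 l + msum n 3 N) +
        (ε ^ 2 + 2 / n) * |psum 2 l - mean₂ n N|) := by
        rw [← mul_add]
        gcongr
        have : (0 : ℝ) ≤ 2 / n := by positivity
        linarith
  · have h1 : 1 ≤ |psum 2 l - mean₂ n N| / n := by
      rw [one_le_div hn']
      exact le_trans (by linarith) (le_abs_self _)
    have h2 : ‖stoppedProd ε b l‖ ≤ H :=
      (norm_stoppedProd_le ε (by linarith) l).trans (hH _ (by linarith))
    have h3 : ‖cexp ((ε * centred l : ℝ) * I +
        (ε ^ 2 * (mean₂ n N - msum n 2 N) / 2 : ℝ))‖ ≤ H := by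
      rw [norm_exp]
      simp only [add_re, mul_re, ofReal_re, ofReal_im, I_re, I_im]
      simp only [mul_zero, zero_mul, sub_zero, zero_add]
      exact hH _ (by linarith)
    have hH0 : 0 ≤ H := (Real.exp_pos _).le
    calc _ ≤ H + H := (norm_sub_le _ _).trans (add_le_add h2 h3)
      _ = H * (0 + 2 * 1) := by ring
      _ ≤ H * (|ε| ^ 3 * (psum 3 l + msum n 3 N) +
          (0 + 2 * (|psum 2 l - mean₂ n N| / n))) := by
        rw [zero_add, zero_add]
        gcongr
        have : 0 ≤ |ε| ^ 3 * (psum 3 l + msum n 3 N) := by positivity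
        linarith
      _ ≤ _ := by
        gcongr
        have e1 : 2 * (|psum 2 l - mean₂ n N| / n) = 2 / n * |psum 2 l - mean₂ n N| := by ring
        have e2 : 0 ≤ ε ^ 2 * |psum 2 l - mean₂ n N| := by positivity
        linarith

end products

open Complex in
theorem exists_charFun_bound (k : ℕ) (θ : ℝ) : ∃ K : ℝ, ∀ n : ℕ, n ≠ 0 →
    ‖1 - avg n (n * k) (fun l => cexp ((θ / √n * centred l : ℝ) * I)) *
      cexp ((θ ^ 2 / n * (mean₂ n (n * k) - msum n 2 (n * k)) / 2 : ℝ))‖ ≤ K / √n := by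
  obtain ⟨C, hC, hbd⟩ := exists_moment_bounds k
  -- The level `b = B n` dominates `msum n 2` and `mean₂ + n`, while `ε² b = θ² B` stays bounded.
  set B := 2 * C + (k : ℝ) ^ 2 / 2 + 1
  have hB : 1 ≤ B := by
    have : 0 ≤ (k : ℝ) ^ 2 / 2 := by positivity
    simp only [B]; linarith
  refine ⟨Real.exp (5 * (θ ^ 2 * B) / 2) * (|θ| ^ 3 * (2 * C) + (θ ^ 2 + 2) * C), fun n hn => ?_⟩
  obtain ⟨-, h2, h3, hM2, hM3, hμ⟩ := hbd n hn
  have hn1 : (1 : ℝ) ≤ n := by exact_mod_cast Nat.pos_of_ne_zero hn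
  have hn' : (0 : ℝ) < n := by linarith
  have hs : 0 < √(n : ℝ) := by positivity
  have hs2 : √(n : ℝ) ^ 2 = n := Real.sq_sqrt hn'.le
  set ε := θ / √(n : ℝ)
  have hε2 : ε ^ 2 = θ ^ 2 / n := by rw [div_pow, hs2]
  have hε3 : |ε| ^ 3 = |θ| ^ 3 / (√n * n) := by
    rw [abs_div, abs_of_pos hs, div_pow]; congr 1; rw [pow_succ, hs2]; ring
  have hb1 : 1 ≤ B * n := by nlinarith
  have hμ' := (abs_le.1 hμ).2
  have hCn : C ≤ C * n := by nlinarith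
  have hb3 : mean₂ n (n * k) + n ≤ B * n := by
    simp only [B]; nlinarith
  have hk2 : 0 ≤ (k : ℝ) ^ 2 / 2 * n := by positivity
  have hb2 : msum n 2 (n * k) ≤ B * n := by
    simp only [B]; nlinarith
  have hμ0 : 0 ≤ mean₂ n (n * k) := Finset.sum_nonneg fun m _ => by
    have := msum_nonneg n 1 m
    positivity
  have hpt := fun (l : List (Fin n)) hl =>
    norm_stoppedProd_sub_exp_le hn ε hb1 hb2 hb3 hμ0 (l := l) hl
  -- The constant 1 becomes the mean of the stopped product, so a pointwise comparison suffices.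
  rw [← avg_stoppedProd hn ε (B * n) (n * k), ← hε2, mul_comm (avg n _ _) (cexp _), ← avg_mul_left_complex, ← avg_sub]
  refine (norm_avg_le _).trans ((avg_mono
    (G := fun l => Real.exp (5 * (ε ^ 2 * (B * n)) / 2) * (|ε| ^ 3 * (psum 3 l + msum n 3 (n * k)) +
        (ε ^ 2 + 2 / n) * |psum 2 l - mean₂ n (n * k)|)) fun l hl => ?_).trans ?_)
  · rw [← Complex.exp_add, add_comm]
    exact hpt l hl
  · rw [avg_mul_left, avg_add, avg_mul_left, avg_mul_left, avg_add, avg_const hn]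
    have e1 : ε ^ 2 * (B * n) = θ ^ 2 * B := by rw [hε2]; field_simp
    rw [e1, mul_div_assoc (Real.exp _)]
    gcongr
    calc _ ≤ |ε| ^ 3 * (C * n + C * n) + (ε ^ 2 + 2 / n) * (C * √n) := by gcongr
      _ = _ := by
        rw [hε3, hε2]
        have key : ∀ s m : ℝ, 0 < s → s ^ 2 = m → |θ| ^ 3 / (s * m) * (C * m + C * m) +
            (θ ^ 2 / m + 2 / m) * (C * s) = (|θ| ^ 3 * (2 * C) + (θ ^ 2 + 2) * C) / s := by
          rintro s _ hs rfl
          field_simp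
          ring
        exact key _ _ hs hs2

/-! ### Second-order expansion of the log-likelihood ratio. -/

theorem abs_log_one_add_sub_le {x : ℝ} (hx : 0 ≤ x) :
    |Real.log (1 + x) - (x - x ^ 2 / 2)| ≤ x ^ 3 / 3 := by
  have hd : ∀ t : ℝ, 0 ≤ t → HasDerivAt (fun t => Real.log (1 + t)) (1 / (1 + t)) t := fun t ht => by
    have h := ((hasDerivAt_id t).const_add 1).log (by simp only [id]; positivity)
    simpa using h
  have hp : ∀ (t : ℝ) (p : ℕ), HasDerivAt (fun t : ℝ => t ^ p) (p * t ^ (p - 1)) t :=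
    fun t p => hasDerivAt_pow p t
  have hf : ∀ t : ℝ, 0 ≤ t → HasDerivAt (fun t => Real.log (1 + t) - (t - t ^ 2 / 2))
      (t ^ 2 / (1 + t)) t := fun t ht => by
    refine ((hd t ht).sub ((hasDerivAt_id t).sub ((hp t 2).div_const 2))).congr_deriv ?_
    have : 1 + t ≠ 0 := by positivity
    field_simp
    push_cast
    ring
  have hg : ∀ t : ℝ, 0 ≤ t → HasDerivAt
      (fun t => t ^ 3 / 3 - (Real.log (1 + t) - (t - t ^ 2 / 2))) (t ^ 3 / (1 + t)) t :=
    fun t ht => by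
    refine (((hp t 3).div_const 3).sub (hf t ht)).congr_deriv ?_
    have : 1 + t ≠ 0 := by positivity
    field_simp
    push_cast
    ring
  have mono : ∀ F F' : ℝ → ℝ, (∀ t, 0 ≤ t → HasDerivAt F (F' t) t) → (∀ t, 0 ≤ t → 0 ≤ F' t) →
      F 0 ≤ F x := fun F F' h h' => by
    refine monotoneOn_of_deriv_nonneg (convex_Ici 0)
      (fun t ht => (h t ht).continuousAt.continuousWithinAt)
      (fun t ht => (h t ?_).differentiableAt.differentiableWithinAt) (fun t ht => ?_)
      Set.self_mem_Ici hx hx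
    · exact (interior_subset ht : t ∈ Set.Ici 0)
    · have h0 : 0 ≤ t := (interior_subset ht : t ∈ Set.Ici 0)
      rw [(h t h0).deriv]
      exact h' t h0
  have h1 := mono _ _ hf fun t ht => by positivity
  have h2 := mono _ _ hg fun t ht => by positivity
  simp only [add_zero, Real.log_one] at h1 h2
  norm_num at h1 h2
  have : 0 ≤ x ^ 3 := by positivity
  rw [abs_le]
  constructor <;> linarith

section

variable {n : ℕ}

/-- The logarithm of the likelihood ratio of the Pólya urn law with initial weights `a` with
respect to the uniform law, for words. -/
def logRatio (a : ℝ) (l : List (Fin n)) : ℝ :=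
  cumul (fun j l => Real.log (1 + l.count j / a)) l -
    ∑ m ∈ Finset.range l.length, Real.log (1 + m / n / a)

theorem cumul_pow_div (a : ℝ) (p : ℕ) (l : List (Fin n)) :
    cumul (fun j l => ((l.count j : ℝ) / a) ^ p) l = psum p l / a ^ p := by
  rw [div_eq_inv_mul, psum, ← cumul_const_mul]
  congr 1
  funext j l
  rw [div_pow, div_eq_inv_mul]

theorem cumul_sub (g h : Fin n → List (Fin n) → ℝ) (l : List (Fin n)) :
    cumul (fun j l => g j l - h j l) l = cumul g l - cumul h l := by
  induction l with
  | nil => simp [cumul]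
  | cons j l ih => simp only [cumul, ih]; ring

theorem cumul_mono {g h : Fin n → List (Fin n) → ℝ} (hgh : ∀ j l, g j l ≤ h j l)
    (l : List (Fin n)) : cumul g l ≤ cumul h l := by
  induction l with
  | nil => simp [cumul]
  | cons j l ih => exact add_le_add ih (hgh j l)

theorem abs_cumul_log_sub_le {a : ℝ} (ha : 0 < a) (l : List (Fin n)) :
    |cumul (fun j l => Real.log (1 + l.count j / a)) l - (psum 1 l / a - psum 2 l / a ^ 2 / 2)| ≤
      psum 3 l / a ^ 3 / 3 := by
  have h2 : psum 1 l / a - psum 2 l / a ^ 2 / 2 =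
      cumul (fun j l => (l.count j : ℝ) / a - ((l.count j : ℝ) / a) ^ 2 / 2) l := by
    have h1 := cumul_pow_div a 1 l
    simp only [pow_one] at h1
    simp only [cumul_sub, h1, div_eq_inv_mul _ (2 : ℝ), cumul_const_mul, cumul_pow_div a 2]
  have h3 : psum 3 l / a ^ 3 / 3 = cumul (fun j l => ((l.count j : ℝ) / a) ^ 3 / 3) l := by
    simp only [div_eq_inv_mul _ (3 : ℝ), cumul_const_mul, cumul_pow_div a 3]
  rw [h2, h3, ← cumul_sub]
  refine (abs_cumul_le _ _).trans (cumul_mono (fun j l => ?_) l)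
  exact abs_log_one_add_sub_le (by positivity)

theorem abs_sum_log_sub_le {a : ℝ} (ha : 0 < a) (n N : ℕ) :
    |∑ m ∈ Finset.range N, Real.log (1 + m / n / a) -
      (msum n 1 N / a - msum n 2 N / a ^ 2 / 2)| ≤ msum n 3 N / a ^ 3 / 3 := by
  have h2 : msum n 1 N / a - msum n 2 N / a ^ 2 / 2 =
      ∑ m ∈ Finset.range N, ((m : ℝ) / n / a - ((m : ℝ) / n / a) ^ 2 / 2) := by
    simp only [msum, Finset.sum_sub_distrib, Finset.sum_div, div_pow, pow_one]
  have h3 : msum n 3 N / a ^ 3 / 3 = ∑ m ∈ Finset.range N, ((m : ℝ) / n / a) ^ 3 / 3 := by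
    simp only [msum, Finset.sum_div, div_pow]
  rw [h2, h3, ← Finset.sum_sub_distrib]
  refine (Finset.abs_sum_le_sum_abs _ _).trans (Finset.sum_le_sum fun m _ => ?_)
  exact abs_log_one_add_sub_le (by positivity)

end

/-- First-order terms combine to `centred / a`. Second-order terms give `-(psum 2 - msum 2) / (2
a²)`, where `psum 2 - msum 2` is `k² n / 2` up to `O(√n)`; third-order terms are `O(n / a³)`. -/
theorem exists_logRatio_bound (k : ℕ) : ∃ C : ℝ, 1 ≤ C ∧ ∀ n : ℕ, n ≠ 0 →
    avg n (n * k) (fun l => |centred l|) ≤ C * √n ∧ ∀ a : ℝ, 0 < a →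
      avg n (n * k) (fun l => |logRatio a l - (centred l / a - (k : ℝ) ^ 2 / 4 * (n / a ^ 2))|) ≤
        C * (√n / a ^ 2 + n / a ^ 3) := by
  obtain ⟨C, hC, hbd⟩ := exists_moment_bounds k
  refine ⟨C, hC, fun n hn => ⟨(hbd n hn).1, fun a ha => ?_⟩⟩
  obtain ⟨-, h2, h3, -, hM3, hμ⟩ := hbd n hn
  have hn1 : (1 : ℝ) ≤ n := by exact_mod_cast Nat.pos_of_ne_zero hn
  have hs : 1 ≤ √(n : ℝ) := Real.one_le_sqrt.2 hn1
  calc _ ≤ avg n (n * k) (fun l => ((2 * a ^ 2)⁻¹ * |psum 2 l - mean₂ n (n * k)| + C / (2 * a ^ 2)) +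
        ((3 * a ^ 3)⁻¹ * psum 3 l + msum n 3 (n * k) / (3 * a ^ 3))) := by
        refine avg_mono fun l hl => ?_
        have e1 := abs_cumul_log_sub_le ha l
        have e2 := abs_sum_log_sub_le ha n (n * k)
        have e : logRatio a l - (centred l / a - (k : ℝ) ^ 2 / 4 * (n / a ^ 2)) =
            -((2 * a ^ 2)⁻¹ * (psum 2 l - mean₂ n (n * k)) + (2 * a ^ 2)⁻¹ *
              (mean₂ n (n * k) - msum n 2 (n * k) - (k : ℝ) ^ 2 / 2 * n)) +
            ((cumul (fun j l => Real.log (1 + l.count j / a)) l -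
              (psum 1 l / a - psum 2 l / a ^ 2 / 2)) -
            (∑ m ∈ Finset.range (n * k), Real.log (1 + m / n / a) -
              (msum n 1 (n * k) / a - msum n 2 (n * k) / a ^ 2 / 2))) := by
          rw [logRatio, centred, hl]
          field_simp
          ring
        rw [e]
        refine (abs_add_le _ _).trans (add_le_add ?_ ((abs_sub _ _).trans ?_))
        · rw [abs_neg]
          refine (abs_add_le _ _).trans ?_
          rw [abs_mul, abs_mul, abs_of_pos (show 0 < (2 * a ^ 2)⁻¹ by positivity), div_eq_inv_mul C]
          gcongr
        · refine (add_le_add e1 e2).trans (le_of_eq ?_)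
          field_simp
    _ ≤ ((2 * a ^ 2)⁻¹ * (C * √n) + C * √n / (2 * a ^ 2)) +
        ((3 * a ^ 3)⁻¹ * (C * n) + C * n / (3 * a ^ 3)) := by
        rw [avg_add, avg_add, avg_add, avg_const hn, avg_const hn, avg_mul_left, avg_mul_left]
        gcongr
        exact le_mul_of_one_le_right (by linarith) hs
    _ = C * (√n / a ^ 2) + 2 / 3 * (C * (n / a ^ 3)) := by field_simp; ring
    _ ≤ _ := by
        have : 0 ≤ C * (n / a ^ 3) := by positivity
        rw [mul_add]
        linarith

/-! ### The central limit theorem. -/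

theorem integral_map_uniform {E : Type} [NormedAddCommGroup E] [NormedSpace ℝ E] [CompleteSpace E]
    (n N : ℕ) (g : List (Fin (n + 1)) → ℝ) (f : ℝ → E) (hf : Continuous f) :
    ∫ x, f x ∂((PMF.uniformOfFintype (Fin N → Fin (n + 1))).toMeasure.map
      fun ω => g (List.ofFn ω)) = avg (n + 1) N fun l => f (g l) := by
  rw [MeasureTheory.integral_map (measurable_of_finite _).aemeasurable
    hf.aestronglyMeasurable, PMF.integral_eq_sum]
  have h : ((n : ENNReal) + 1).toReal = (n : ℝ) + 1 := by
    exact_mod_cast ENNReal.toReal_natCast (n + 1)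
  simp [avg, Finset.smul_sum, h]

/-- The central limit theorem for the number of pairs of equal letters. -/
theorem tendsto_avg_centred (k : ℕ) (f : BoundedContinuousFunction ℝ ℝ) :
    Tendsto (fun n : ℕ => avg n (n * k) fun l => f (centred l / √n)) atTop
      (𝓝 (∫ x, f x ∂gaussianReal 0 (Real.toNNReal ((k : ℝ) ^ 2 / 2)))) := by
  -- The shift makes the alphabet nonempty, so that the uniform law on words exists for every index.
  rw [← tendsto_add_atTop_iff_nat 1]
  let P : ℕ → MeasureTheory.ProbabilityMeasure ℝ := fun n =>
    ⟨(PMF.uniformOfFintype (Fin ((n + 1) * k) → Fin (n + 1))).toMeasure.map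
      fun ω => centred (List.ofFn ω) / √((n + 1 : ℕ) : ℝ),
      MeasureTheory.Measure.isProbabilityMeasure_map (measurable_of_finite _).aemeasurable⟩
  let G : MeasureTheory.ProbabilityMeasure ℝ :=
    ⟨gaussianReal 0 (Real.toNNReal ((k : ℝ) ^ 2 / 2)), inferInstance⟩
  suffices h : Tendsto P atTop (𝓝 G) by
    refine (MeasureTheory.ProbabilityMeasure.tendsto_iff_forall_integral_tendsto.1 h f).congr
      fun n => ?_
    exact integral_map_uniform n ((n + 1) * k) (fun l => centred l / √((n + 1 : ℕ) : ℝ)) f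
      f.continuous
  rw [MeasureTheory.ProbabilityMeasure.tendsto_iff_tendsto_charFun]
  intro θ
  change Tendsto _ _ (𝓝 (MeasureTheory.charFun (gaussianReal 0 _) θ))
  rw [charFun_gaussianReal]
  let A : ℕ → ℂ := fun n =>
    avg n (n * k) (fun l => Complex.exp ((θ / √n * centred l : ℝ) * Complex.I))
  let κ : ℕ → ℝ := fun n => θ ^ 2 / n * (mean₂ n (n * k) - msum n 2 (n * k)) / 2
  have hA : ∀ n, MeasureTheory.charFun ((P n : MeasureTheory.ProbabilityMeasure ℝ) :
      MeasureTheory.Measure ℝ) θ = A (n + 1) := fun n => by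
    rw [MeasureTheory.charFun_apply_real]
    refine (integral_map_uniform n ((n + 1) * k) (fun l => centred l / √((n + 1 : ℕ) : ℝ))
      (fun x : ℝ => Complex.exp (θ * x * Complex.I)) (by fun_prop)).trans ?_
    refine avg_congr fun l _ => ?_
    congr 2
    push_cast
    ring
  simp only [hA]
  have hsq : Tendsto (fun n : ℕ => √(n : ℝ)) atTop atTop :=
    Real.tendsto_sqrt_atTop.comp tendsto_natCast_atTop_atTop
  have hκ : Tendsto κ atTop (𝓝 (θ ^ 2 * (k : ℝ) ^ 2 / 4)) := by
    obtain ⟨C, hC, hbd⟩ := exists_moment_bounds k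
    rw [tendsto_iff_norm_sub_tendsto_zero]
    refine squeeze_zero' (Eventually.of_forall fun _ => norm_nonneg _) (g := fun n : ℕ =>
      θ ^ 2 / 2 * C / n) ?_ (tendsto_const_div_atTop_nhds_zero_nat _)
    filter_upwards [eventually_ne_atTop 0] with n hn
    have hn' : (0 : ℝ) < n := by exact_mod_cast Nat.pos_of_ne_zero hn
    obtain ⟨-, -, -, -, -, hμ⟩ := hbd n hn
    have : κ n - θ ^ 2 * (k : ℝ) ^ 2 / 4 = θ ^ 2 / 2 / n *
        (mean₂ n (n * k) - msum n 2 (n * k) - (k : ℝ) ^ 2 / 2 * n) := by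
      simp only [κ]; field_simp; ring
    rw [this, Real.norm_eq_abs, abs_mul, abs_of_nonneg (by positivity), mul_div_right_comm]
    gcongr
  obtain ⟨K, hK⟩ := exists_charFun_bound k θ
  -- The characteristic function times `exp κ` tends to 1 and `κ` converges, so dividing gives the
  -- Gaussian limit.
  have h1 : Tendsto (fun n => A n * Complex.exp (κ n : ℝ)) atTop (𝓝 1) := by
    rw [tendsto_iff_norm_sub_tendsto_zero]
    refine squeeze_zero' (Eventually.of_forall fun _ => norm_nonneg _) ?_
      (tendsto_const_nhds.div_atTop hsq (a := K))
    filter_upwards [eventually_ne_atTop 0] with n hn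
    rw [norm_sub_rev]
    exact hK n hn
  have h2 : Tendsto (fun n => Complex.exp (-(κ n : ℝ))) atTop
      (𝓝 (Complex.exp (-((θ ^ 2 * (k : ℝ) ^ 2 / 4 : ℝ) : ℂ)))) :=
    (Complex.continuous_exp.tendsto _).comp
      ((Complex.continuous_ofReal.tendsto _).comp hκ).neg
  have h3 := h1.mul h2
  refine ((tendsto_add_atTop_iff_nat 1).2 h3).congr' ?_ |>.trans (le_of_eq ?_)
  · refine Eventually.of_forall fun n => ?_
    simp only [mul_assoc, ← Complex.exp_add, add_neg_cancel, Complex.exp_zero, mul_one]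
  · rw [one_mul]
    congr 2
    rw [Real.coe_toNNReal _ (by positivity)]
    push_cast
    ring

/-! ### The function `(1 - e^y)⁺` and its Gaussian integral. -/

/-- `(1 - e^y)⁺`. -/
def deficit (y : ℝ) : ℝ := max 0 (1 - Real.exp y)

theorem deficit_nonneg (y : ℝ) : 0 ≤ deficit y := le_max_left _ _

theorem deficit_le_one (y : ℝ) : deficit y ≤ 1 :=
  max_le zero_le_one (by linarith [Real.exp_pos y])

theorem continuous_deficit : Continuous deficit := by unfold deficit; fun_prop

/-- The slope of `1 - e^y` is at most one in modulus for `y ≤ 0`, and the positive part vanishes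
beyond. Being 1-Lipschitz transfers L¹ estimates on `logRatio` to the distance. -/
theorem deficit_sub_le (x y : ℝ) : deficit x - deficit y ≤ |x - y| := by
  by_cases hx : 0 ≤ x
  · have : deficit x = 0 := max_eq_left (by linarith [Real.one_le_exp hx])
    rw [this]
    linarith [deficit_nonneg y, abs_nonneg (x - y)]
  · have h1 : deficit x = 1 - Real.exp x :=
      max_eq_right (by linarith [Real.exp_le_one_iff.2 (not_le.1 hx).le])
    have h2 : 1 - Real.exp y ≤ deficit y := le_max_right _ _
    have h3 : Real.exp y = Real.exp x * Real.exp (y - x) := by rw [← Real.exp_add]; congr 1; ring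
    have h4 : Real.exp x ≤ 1 := Real.exp_le_one_iff.2 (not_le.1 hx).le
    rw [h1]
    rcases le_total y x with h | h
    · have h5 : Real.exp y ≤ Real.exp x := Real.exp_le_exp.2 h
      linarith [abs_nonneg (x - y)]
    · have h6 : deficit y = max 0 (1 - Real.exp y) := rfl
      rw [abs_of_nonpos (by linarith)]
      by_cases hy : 0 ≤ y
      · have := Real.add_one_le_exp x
        linarith [deficit_nonneg y]
      · have h7 : Real.exp y ≤ 1 := Real.exp_le_one_iff.2 (not_le.1 hy).le
        have h8 := Real.add_one_le_exp (x - y)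
        have h9 : Real.exp x = Real.exp y * Real.exp (x - y) := by
          rw [← Real.exp_add]; congr 1; ring
        nlinarith [Real.exp_pos y]

theorem abs_deficit_sub_le (x y : ℝ) : |deficit x - deficit y| ≤ |x - y| :=
  abs_sub_le_iff.2 ⟨deficit_sub_le x y, by rw [abs_sub_comm]; exact deficit_sub_le y x⟩

/-- Either `y ≤ -c / 2`, or `|y + c| ≥ c / 2` and the second term is at least one. -/
theorem one_sub_deficit_le {c : ℝ} (hc : 0 < c) (y : ℝ) :
    1 - deficit y ≤ Real.exp (-(c / 2)) + 2 / c * |y + c| := by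
  have h1 : 1 - Real.exp y ≤ deficit y := le_max_right _ _
  have h2 := deficit_nonneg y
  by_cases h : y ≤ -(c / 2)
  · have : Real.exp y ≤ Real.exp (-(c / 2)) := Real.exp_le_exp.2 h
    have : 0 ≤ 2 / c * |y + c| := by positivity
    linarith
  · have h3 : c / 2 ≤ |y + c| := le_trans (by linarith) (le_abs_self _)
    have h4 : 2 / c * (c / 2) ≤ 2 / c * |y + c| := by gcongr
    have h5 : 2 / c * (c / 2) = 1 := by field_simp
    linarith [Real.exp_pos (-(c / 2))]

/-- When the variance is twice the mean, `E exp (-N) = 1`, so the positive part of `1 - exp (-N)`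
carries exactly half of the absolute integral. -/
theorem integral_deficit_gaussian (m β : ℝ) (s : NNReal) (hs : (s : ℝ) / β ^ 2 = 2 * m) :
    ∫ x, deficit (x / β - m) ∂gaussianReal 0 s =
      1 / 2 * ∫ x : ℝ, |1 - Real.exp (-x)| ∂gaussianReal m (Real.toNNReal (2 * m)) := by
  have hv : Real.toNNReal (2 * m) = NNReal.mk ((-β⁻¹) ^ 2) (sq_nonneg _) * s := by
    apply NNReal.eq
    rw [← hs, Real.coe_toNNReal _ (by positivity), NNReal.coe_mul, NNReal.coe_mk]
    simp [div_eq_inv_mul]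
  have hmap : (gaussianReal 0 s).map (fun x => -β⁻¹ * x + m) =
      gaussianReal m (Real.toNNReal (2 * m)) := by
    have h1 := gaussianReal_map_const_mul (μ := 0) (v := s) (-β⁻¹)
    have h2 := gaussianReal_map_add_const (μ := -β⁻¹ * 0) (v := Real.toNNReal (2 * m)) m
    rw [hv, ← h1, MeasureTheory.Measure.map_map (by fun_prop) (by fun_prop)] at h2
    rw [hv]
    simpa [Function.comp_def] using h2
  have hint : MeasureTheory.Integrable (fun x : ℝ => Real.exp (-x))
      (gaussianReal m (Real.toNNReal (2 * m))) := by
    simpa using integrable_exp_mul_gaussianReal (μ := m) (v := Real.toNNReal (2 * m)) (-1)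
  have hm0 : 0 ≤ 2 * m := by rw [← hs]; positivity
  have hexp : ∫ x : ℝ, Real.exp (-x) ∂gaussianReal m (Real.toNNReal (2 * m)) = 1 := by
    have := congrFun (mgf_id_gaussianReal (μ := m) (v := Real.toNNReal (2 * m))) (-1)
    simp only [mgf, id, neg_mul, one_mul] at this
    rw [this, Real.coe_toNNReal _ hm0]
    ring_nf
    simp
  have habs : ∀ x : ℝ, deficit (-x) = 1 / 2 * (|1 - Real.exp (-x)| + (1 - Real.exp (-x))) :=
    fun x => by
    rw [deficit]
    rcases le_total 0 (1 - Real.exp (-x)) with h | h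
    · rw [max_eq_right h, abs_of_nonneg h]; ring
    · rw [max_eq_left h, abs_of_nonpos h]; ring
  calc _ = ∫ x, deficit (-(-β⁻¹ * x + m)) ∂gaussianReal 0 s := by
        congr 1; funext x; congr 1; rw [div_eq_inv_mul]; ring
    _ = ∫ x, deficit (-x) ∂gaussianReal m (Real.toNNReal (2 * m)) := by
        rw [← hmap, MeasureTheory.integral_map (by fun_prop)]
        exact (continuous_deficit.comp continuous_neg).aestronglyMeasurable
    _ = _ := by
        have hi : MeasureTheory.Integrable (fun x : ℝ => 1 - Real.exp (-x))
          (gaussianReal m (Real.toNNReal (2 * m))) := (MeasureTheory.integrable_const _).sub hint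
        simp only [habs]
        rw [MeasureTheory.integral_const_mul, MeasureTheory.integral_add hi.abs hi,
          MeasureTheory.integral_sub (MeasureTheory.integrable_const _) hint, hexp]
        simp

/-! ### The three regimes. -/

section asymptotics

variable (k : ℕ) (a : ℕ → ℝ) (ha : ∀ n, 0 < a n)

theorem tendsto_sqrt_natCast : Tendsto (fun n : ℕ => √(n : ℝ)) atTop atTop :=
  Real.tendsto_sqrt_atTop.comp tendsto_natCast_atTop_atTop

include ha

theorem tendsto_avg_deficit_zero (h : Tendsto (fun n : ℕ => a n / √(n : ℝ)) atTop atTop) :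
    Tendsto (fun n : ℕ => avg n (n * k) fun l => deficit (logRatio (a n) l)) atTop (𝓝 0) := by
  obtain ⟨C, hC, hbd⟩ := exists_logRatio_bound k
  have ha' : Tendsto (fun n => (a n)⁻¹) atTop (𝓝 0) := by
    refine (Tendsto.congr' ?_ (h.atTop_mul_atTop₀ tendsto_sqrt_natCast)).inv_tendsto_atTop
    filter_upwards [eventually_ne_atTop 0] with n hn
    have : (0 : ℝ) < n := by exact_mod_cast Nat.pos_of_ne_zero hn
    field_simp
  have hu := h.inv_tendsto_atTop
  refine squeeze_zero' (Eventually.of_forall fun n => avg_nonneg fun l => deficit_nonneg _)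
    (g := fun n => C * ((a n / √n)⁻¹ * (a n)⁻¹ + (a n / √n)⁻¹ ^ 2 * (a n)⁻¹) +
      C * (a n / √n)⁻¹ + (k : ℝ) ^ 2 / 4 * (a n / √n)⁻¹ ^ 2) ?_ ?_
  · filter_upwards [eventually_ne_atTop 0] with n hn
    obtain ⟨h1, h2⟩ := hbd n hn
    have han := ha n
    have hn' : (0 : ℝ) < n := by exact_mod_cast Nat.pos_of_ne_zero hn
    have hs2 : √(n : ℝ) ^ 2 = n := Real.sq_sqrt hn'.le
    calc _ ≤ avg n (n * k) (fun l =>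
          |logRatio (a n) l - (centred l / a n - (k : ℝ) ^ 2 / 4 * (n / a n ^ 2))| +
            (a n)⁻¹ * |centred l| + (k : ℝ) ^ 2 / 4 * (n / a n ^ 2)) := by
          refine avg_mono fun l _ => ?_
          have e1 := deficit_sub_le (logRatio (a n) l) 0
          have e2 : deficit 0 = 0 := by simp [deficit]
          rw [e2, sub_zero, sub_zero] at e1
          refine e1.trans ?_
          have e3 : logRatio (a n) l =
            (logRatio (a n) l - (centred l / a n - (k : ℝ) ^ 2 / 4 * (n / a n ^ 2))) +
              (a n)⁻¹ * centred l - (k : ℝ) ^ 2 / 4 * (n / a n ^ 2) := by ring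
          have e4 : |(a n)⁻¹ * centred l| = (a n)⁻¹ * |centred l| := by
            rw [abs_mul, abs_of_pos (inv_pos.2 han)]
          have e5 : |(k : ℝ) ^ 2 / 4 * (n / a n ^ 2)| = (k : ℝ) ^ 2 / 4 * (n / a n ^ 2) :=
            abs_of_nonneg (by positivity)
          rw [← e4]
          nth_rewrite 1 [e3]
          refine (abs_sub _ _).trans ?_
          rw [e5]
          gcongr
          exact abs_add_le _ _
      _ ≤ C * (√n / a n ^ 2 + n / a n ^ 3) + (a n)⁻¹ * (C * √n) +
          (k : ℝ) ^ 2 / 4 * (n / a n ^ 2) := by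
          rw [avg_add, avg_add, avg_const hn, avg_mul_left]
          gcongr
          exact h2 _ han
      _ = _ := by
          have key : ∀ s m x : ℝ, 0 < s → 0 < x → s ^ 2 = m →
              C * (s / x ^ 2 + m / x ^ 3) + x⁻¹ * (C * s) + (k : ℝ) ^ 2 / 4 * (m / x ^ 2) =
              C * ((x / s)⁻¹ * x⁻¹ + (x / s)⁻¹ ^ 2 * x⁻¹) + C * (x / s)⁻¹ +
                (k : ℝ) ^ 2 / 4 * (x / s)⁻¹ ^ 2 := by
            rintro s _ x hs hx rfl
            field_simp
          exact key _ _ _ (by positivity) han hs2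
  · have := (((hu.mul ha').add ((hu.pow 2).mul ha')).const_mul C).add (hu.const_mul C)
      |>.add ((hu.pow 2).const_mul ((k : ℝ) ^ 2 / 4))
    simpa using this

/-- The drift `c = k² n / (4 a²)` tends to infinity. Relative to it, the expansion errors and the
fluctuation `√n / a` are of order `1 / √n`, `1 / a` and `a / √n`; the middle one is where `a → ∞`
enters. -/
theorem tendsto_avg_deficit_one (hk : 1 ≤ k) (h : Tendsto a atTop atTop)
    (h' : Tendsto (fun n : ℕ => a n / √(n : ℝ)) atTop (𝓝 0)) :
    Tendsto (fun n : ℕ => avg n (n * k) fun l => deficit (logRatio (a n) l)) atTop (𝓝 1) := by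
  obtain ⟨C, hC, hbd⟩ := exists_logRatio_bound k
  have hk' : (0 : ℝ) < k := by exact_mod_cast hk
  have hs : Tendsto (fun n : ℕ => (√(n : ℝ))⁻¹) atTop (𝓝 0) :=
    tendsto_sqrt_natCast.inv_tendsto_atTop
  have hpos : ∀ᶠ n in atTop, 0 < a n / √(n : ℝ) := by
    filter_upwards [eventually_ne_atTop 0] with n hn
    have : (0 : ℝ) < n := by exact_mod_cast Nat.pos_of_ne_zero hn
    have := ha n
    positivity
  have hu : Tendsto (fun n : ℕ => (a n / √(n : ℝ))⁻¹) atTop atTop :=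
    (tendsto_nhdsWithin_iff.2 ⟨h', hpos⟩).inv_tendsto_nhdsGT_zero
  have hexp : Tendsto (fun n : ℕ => Real.exp (-((k : ℝ) ^ 2 / 8 * (a n / √(n : ℝ))⁻¹ ^ 2)))
      atTop (𝓝 0) :=
    Real.tendsto_exp_neg_atTop_nhds_zero.comp
      (((tendsto_pow_atTop two_ne_zero).comp hu).const_mul_atTop (by positivity))
  suffices hlim : Tendsto (fun n : ℕ => 1 - avg n (n * k) fun l => deficit (logRatio (a n) l))
      atTop (𝓝 0) by
    simpa using hlim.const_sub 1
  refine squeeze_zero' (g := fun n : ℕ =>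
    Real.exp (-((k : ℝ) ^ 2 / 8 * (a n / √(n : ℝ))⁻¹ ^ 2)) +
      8 * C / (k : ℝ) ^ 2 * ((√(n : ℝ))⁻¹ + (a n)⁻¹ + a n / √(n : ℝ))) ?_ ?_ ?_
  · filter_upwards [eventually_ne_atTop 0] with n hn
    rw [sub_nonneg, ← avg_const hn (N := n * k) (1 : ℝ)]
    exact avg_mono fun l _ => deficit_le_one _
  · filter_upwards [eventually_ne_atTop 0] with n hn
    obtain ⟨h1, h2⟩ := hbd n hn
    have han := ha n
    have hn' : (0 : ℝ) < n := by exact_mod_cast Nat.pos_of_ne_zero hn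
    have hs2 : √(n : ℝ) ^ 2 = n := Real.sq_sqrt hn'.le
    have hs0 : 0 < √(n : ℝ) := by positivity
    set c := (k : ℝ) ^ 2 / 4 * (n / a n ^ 2)
    have hc : 0 < c := by positivity
    calc _ = avg n (n * k) fun l => 1 - deficit (logRatio (a n) l) := by
          rw [avg_sub, avg_const hn]
      _ ≤ avg n (n * k) (fun l => Real.exp (-(c / 2)) + 2 / c *
          (|logRatio (a n) l - (centred l / a n - c)| + (a n)⁻¹ * |centred l|)) := by
          refine avg_mono fun l _ => (one_sub_deficit_le hc _).trans ?_
          have e3 : logRatio (a n) l + c =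
            (logRatio (a n) l - (centred l / a n - c)) + (a n)⁻¹ * centred l := by ring
          have e4 : |(a n)⁻¹ * centred l| = (a n)⁻¹ * |centred l| := by
            rw [abs_mul, abs_of_pos (inv_pos.2 han)]
          rw [e3, ← e4]
          gcongr
          exact abs_add_le _ _
      _ ≤ Real.exp (-(c / 2)) + 2 / c * (C * (√n / a n ^ 2 + n / a n ^ 3) +
          (a n)⁻¹ * (C * √n)) := by
          rw [avg_add, avg_const hn, avg_mul_left, avg_add, avg_mul_left]
          gcongr
          exact h2 _ han
      _ = _ := by
          have hsn : (n : ℝ) = √n ^ 2 := hs2.symm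
          have hc' : c = (k : ℝ) ^ 2 / 4 * (√(n : ℝ) ^ 2 / a n ^ 2) := by rw [hs2]
          congr 1
          · congr 2
            rw [hc']
            field_simp
            norm_num
          · rw [hc']
            have : (n : ℝ) / a n ^ 3 = √n ^ 2 / a n ^ 3 := by rw [hs2]
            rw [this]
            field_simp
            ring
  · have := hexp.add (((hs.add h.inv_tendsto_atTop).add h').const_mul (8 * C / (k : ℝ) ^ 2))
    simpa using this

theorem tendsto_avg_deficit_gaussian {β : ℝ} (hβ : 0 < β)
    (h : ∀ n : ℕ, 1 ≤ n → a n = β * √(n : ℝ)) :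
    Tendsto (fun n : ℕ => avg n (n * k) fun l => deficit (logRatio (a n) l)) atTop
      (𝓝 (1 / 2 * ∫ x : ℝ, |1 - Real.exp (-x)| ∂gaussianReal ((k : ℝ) ^ 2 / (4 * β ^ 2))
        (Real.toNNReal ((k : ℝ) ^ 2 / (2 * β ^ 2))))) := by
  obtain ⟨C, hC, hbd⟩ := exists_logRatio_bound k
  have hs : Tendsto (fun n : ℕ => (√(n : ℝ))⁻¹) atTop (𝓝 0) :=
    tendsto_sqrt_natCast.inv_tendsto_atTop
  set m := (k : ℝ) ^ 2 / (4 * β ^ 2)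
  have hm : (k : ℝ) ^ 2 / (2 * β ^ 2) = 2 * m := by simp only [m]; field_simp; norm_num
  let f : BoundedContinuousFunction ℝ ℝ := BoundedContinuousFunction.ofNormedAddCommGroup
    (fun x => deficit (x / β - m)) (continuous_deficit.comp (by fun_prop)) 1 fun x => by
      rw [Real.norm_of_nonneg (deficit_nonneg _)]; exact deficit_le_one _
  have hlim := tendsto_avg_centred k f
  have hI : ∫ x, f x ∂gaussianReal 0 (Real.toNNReal ((k : ℝ) ^ 2 / 2)) = _ :=
    integral_deficit_gaussian m β (Real.toNNReal ((k : ℝ) ^ 2 / 2)) (by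
      rw [Real.coe_toNNReal _ (by positivity), ← hm]; field_simp)
  rw [hI] at hlim
  rw [hm]
  refine hlim.congr_dist (squeeze_zero' (Eventually.of_forall fun _ => dist_nonneg)
    (g := fun n : ℕ => C * ((β ^ 2)⁻¹ + (β ^ 3)⁻¹) * (√(n : ℝ))⁻¹) ?_ ?_)
  · filter_upwards [eventually_ge_atTop 1] with n hn
    have hn0 : n ≠ 0 := by omega
    obtain ⟨-, h2⟩ := hbd n hn0
    have hn' : (0 : ℝ) < n := by exact_mod_cast hn
    have hs2 : √(n : ℝ) ^ 2 = n := Real.sq_sqrt hn'.le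
    have hs0 : 0 < √(n : ℝ) := by positivity
    rw [dist_comm, Real.dist_eq, ← avg_sub]
    refine (abs_avg_le _).trans ((avg_mono fun l _ => abs_deficit_sub_le _ _).trans ?_)
    have e1 : ∀ l : List (Fin n), centred l / √(n : ℝ) / β - m =
        centred l / a n - (k : ℝ) ^ 2 / 4 * (n / a n ^ 2) := fun l => by
      rw [h n hn, mul_pow, hs2]
      simp only [m]
      field_simp
    simp only [e1]
    refine (h2 _ (ha n)).trans (le_of_eq ?_)
    rw [h n hn]
    have key : ∀ s m : ℝ, 0 < s → s ^ 2 = m → C * (s / (β * s) ^ 2 + m / (β * s) ^ 3) =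
        C * ((β ^ 2)⁻¹ + (β ^ 3)⁻¹) * s⁻¹ := by
      rintro s _ hs rfl
      field_simp
    exact key _ _ hs0 hs2
  · simpa using hs.const_mul (C * ((β ^ 2)⁻¹ + (β ^ 3)⁻¹))

end asymptotics

/-! ### Expectations on finite types. -/

section expect

variable {Ω Ω' : Type} [Fintype Ω] [Fintype Ω']

/-- The expectation of `g` under a probability mass function on a finite type. -/
def expect (p : PMF Ω) (g : Ω → ℝ) : ℝ := ∑ s, (p s).toReal * g s

theorem expect_bind (p : PMF Ω) (f : Ω → PMF Ω') (g : Ω' → ℝ) :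
    expect (p.bind f) g = expect p fun s => expect (f s) g := by
  unfold expect
  simp only [PMF.bind_apply, tsum_fintype, Finset.mul_sum]
  rw [Finset.sum_comm]
  refine Finset.sum_congr rfl fun s _ => ?_
  rw [ENNReal.toReal_sum fun a _ => ENNReal.mul_ne_top (p.apply_ne_top a) ((f a).apply_ne_top s),
    Finset.sum_mul]
  exact Finset.sum_congr rfl fun a _ => by rw [ENNReal.toReal_mul, mul_assoc]

theorem expect_pure (s : Ω) (g : Ω → ℝ) : expect (PMF.pure s) g = g s := by
  classical
  unfold expect
  rw [Finset.sum_eq_single s]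
  · simp
  · intro b _ hb
    simp [hb]
  · simp

theorem expect_map (p : PMF Ω) (f : Ω → Ω') (g : Ω' → ℝ) :
    expect (p.map f) g = expect p fun s => g (f s) := by
  rw [← PMF.bind_pure_comp, expect_bind]
  simp only [Function.comp_apply, expect_pure]

theorem expect_congr {p : PMF Ω} {g h : Ω → ℝ} (H : ∀ s ∈ p.support, g s = h s) :
    expect p g = expect p h := by
  refine Finset.sum_congr rfl fun s _ => ?_
  by_cases hs : s ∈ p.support
  · rw [H s hs]
  · rw [(PMF.apply_eq_zero_iff p s).2 hs]; simp

theorem expect_uniformOfFinset (S : Finset Ω) (hS : S.Nonempty) (g : Ω → ℝ) :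
    expect (PMF.uniformOfFinset S hS) g = (S.card : ℝ)⁻¹ * ∑ s ∈ S, g s := by
  classical
  unfold expect
  rw [Finset.mul_sum, ← Finset.sum_subset (Finset.subset_univ S)]
  · refine Finset.sum_congr rfl fun s hs => ?_
    rw [PMF.uniformOfFinset_apply_of_mem _ hs]
    simp
  · intro s _ hs
    rw [PMF.uniformOfFinset_apply_of_notMem _ hs]
    simp

theorem expect_single [DecidableEq Ω] (p : PMF Ω) (s : Ω) :
    expect p (fun x => if x = s then 1 else 0) = (p s).toReal := by
  simp [expect]

end expect

/-! ### The exact law of the terminal map. -/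

section process

variable {n k : ℕ}

/-- The number of arcs already inserted. -/
def size (s : PartialMap n k) : ℕ := ∑ j, inDeg s j

/-- In `s`, the arcs of `v` inserted so far are those with labels below `o v`. -/
def IsInitial (s : PartialMap n k) (o : Fin n → ℕ) : Prop :=
  (∀ v, o v ≤ k) ∧ ∀ v i, (s v i).isSome ↔ (i : ℕ) < o v

theorem IsInitial.outDeg_eq {s : PartialMap n k} {o : Fin n → ℕ} (h : IsInitial s o) (v : Fin n) :
    outDeg s v = o v := by
  unfold outDeg
  simp only [h.2]
  rw [Fin.card_filter_val_lt, min_eq_right (h.1 v)]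

theorem isInitial_empty : IsInitial (fun _ _ => none : PartialMap n k) fun _ => 0 :=
  ⟨fun _ => Nat.zero_le _, fun _ _ => by simp⟩

theorem IsInitial.eq_none {s : PartialMap n k} {o : Fin n → ℕ} (h : IsInitial s o) {v : Fin n}
    {i : Fin k} (hi : (i : ℕ) = o v) : s v i = none := by
  have := h.2 v i
  rw [hi, lt_self_iff_false, iff_false] at this
  simpa using this

theorem IsInitial.insertArc_apply {s : PartialMap n k} {o : Fin n → ℕ} (h : IsInitial s o)
    {v : Fin n} {i : Fin k} (hi : (i : ℕ) = o v) (j w : Fin n) (i' : Fin k) :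
    insertArc s v j w i' = if (w, i') = (v, i) then some j else s w i' := by
  unfold insertArc
  rw [h.outDeg_eq, ← hi]
  by_cases hw : w = v
  · subst hw
    simp [Fin.ext_iff]
  · simp [hw]

theorem IsInitial.insertArc {s : PartialMap n k} {o : Fin n → ℕ} (h : IsInitial s o)
    {v : Fin n} (hv : o v < k) (j : Fin n) :
    IsInitial (insertArc s v j) (Function.update o v (o v + 1)) := by
  refine ⟨fun w => ?_, fun w i => ?_⟩
  · by_cases hw : w = v
    · subst hw; simpa using hv
    · simpa [hw] using h.1 w
  · rw [h.insertArc_apply (i := ⟨o v, hv⟩) rfl]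
    by_cases hw : w = v
    · subst hw
      by_cases hi : i = ⟨o w, hv⟩
      · simp [hi]
      · have : (i : ℕ) ≠ o w := fun e => hi (Fin.ext e)
        simp [hi, h.2]
        omega
    · simp [hw, h.2]

theorem IsInitial.inDeg_insertArc {s : PartialMap n k} {o : Fin n → ℕ} (h : IsInitial s o)
    {v : Fin n} (hv : o v < k) (j j' : Fin n) :
    inDeg (KOut.insertArc s v j) j' = inDeg s j' + if j' = j then 1 else 0 := by
  have hn : s v ⟨o v, hv⟩ = none := h.eq_none rfl
  unfold inDeg
  rw [Finset.card_filter, Finset.card_filter]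
  have : ∀ a : Fin n × Fin k, (if KOut.insertArc s v j a.1 a.2 = some j' then 1 else 0) =
      (if s a.1 a.2 = some j' then 1 else 0) +
        if a = (v, ⟨o v, hv⟩) then (if j' = j then 1 else 0) else 0 := by
    intro a
    rw [h.insertArc_apply (i := ⟨o v, hv⟩) rfl]
    by_cases ha : a = (v, ⟨o v, hv⟩)
    · subst ha
      simp [hn, eq_comm]
    · simp [ha]
  simp only [this, Finset.sum_add_distrib]
  simp

theorem IsInitial.size_insertArc {s : PartialMap n k} {o : Fin n → ℕ} (h : IsInitial s o)
    {v : Fin n} (hv : o v < k) (j : Fin n) : size (KOut.insertArc s v j) = size s + 1 := by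
  simp [size, h.inDeg_insertArc hv, Finset.sum_add_distrib]

theorem size_eq_card (s : PartialMap n k) :
    size s = (Finset.univ.filter fun a : Fin n × Fin k => (s a.1 a.2).isSome).card := by
  unfold size inDeg
  simp only [Finset.card_filter]
  rw [Finset.sum_comm]
  refine Finset.sum_congr rfl fun a _ => ?_
  cases h : s a.1 a.2 <;> simp

theorem isSome_of_size_eq {s : PartialMap n k} (h : size s = n * k) (v : Fin n)
    (i : Fin k) : (s v i).isSome := by
  rw [size_eq_card] at h
  have h2 : (Finset.univ.filter fun a : Fin n × Fin k => (s a.1 a.2).isSome) = Finset.univ :=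
    Finset.eq_univ_of_card _ (by simp [h])
  have := Finset.mem_univ (v, i)
  rw [← h2] at this
  simpa using this

theorem IsInitial.mem_unsaturated {s : PartialMap n k} {o : Fin n → ℕ} (h : IsInitial s o)
    (v : Fin n) : v ∈ unsaturated s ↔ o v < k := by
  simp [unsaturated, h.outDeg_eq]

theorem support_step_subset (α : Set.Ioi (0 : ℝ)) {s s' : PartialMap n k}
    (h : s' ∈ (step α s).support) :
    (∃ v ∈ unsaturated s, ∃ j, s' = insertArc s v j) ∨ unsaturated s = ∅ ∧ s' = s := by
  unfold step at h
  split_ifs at h with hu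
  · left
    simp only [PMF.mem_support_bind_iff, PMF.mem_support_map_iff,
      PMF.mem_support_uniformOfFinset_iff] at h
    obtain ⟨v, hv, j, -, rfl⟩ := h
    exact ⟨v, hv, j, rfl⟩
  · right
    exact ⟨Finset.not_nonempty_iff_eq_empty.1 hu, by simpa using h⟩

/-- The saturated alternative covers the idle steps of the process; at time `k * n` either
alternative means that all arcs are present. -/
theorem support_process (α : Set.Ioi (0 : ℝ)) (t : ℕ) {s : PartialMap n k}
    (h : s ∈ (process n k α t).support) :
    ∃ o, IsInitial s o ∧ (size s = t ∨ unsaturated s = ∅) := by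
  induction t generalizing s with
  | zero =>
    have : s = fun _ _ => none := by simpa [process] using h
    subst this
    exact ⟨_, isInitial_empty, Or.inl (by simp [size, inDeg])⟩
  | succ t ih =>
    rw [process, PMF.mem_support_bind_iff] at h
    obtain ⟨s₀, h₀, h⟩ := h
    obtain ⟨o, ho, hs⟩ := ih h₀
    rcases support_step_subset α h with ⟨v, hv, j, rfl⟩ | ⟨hu, rfl⟩
    · have hv' := (ho.mem_unsaturated v).1 hv
      refine ⟨_, ho.insertArc hv' j, Or.inl ?_⟩
      rw [ho.size_insertArc hv']
      rcases hs with hs | hs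
      · rw [hs]
      · rw [hs] at hv
        exact absurd hv (Finset.notMem_empty v)
    · exact ⟨o, ho, Or.inr hu⟩

theorem isSome_of_mem_support (α : Set.Ioi (0 : ℝ)) {s : PartialMap n k}
    (h : s ∈ (process n k α (k * n)).support) (v : Fin n) (i : Fin k) : (s v i).isSome := by
  obtain ⟨o, ho, hs | hs⟩ := support_process α _ h
  · exact isSome_of_size_eq (by rw [hs, mul_comm]) v i
  · rw [ho.2]
    have : v ∉ unsaturated s := by rw [hs]; exact Finset.notMem_empty v
    rw [ho.mem_unsaturated] at this
    omega

/-- The arcs inserted so far agree with those of `M`. -/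
def Agrees (M : KOutMap n k) (s : PartialMap n k) : Prop := ∀ v i, s v i = none ∨ s v i = some (M v i)

/-- The rising factorial `a (a + 1) ⋯ (a + d - 1)`. -/
def rising (a : ℝ) (d : ℕ) : ℝ := ∏ i ∈ Finset.range d, (a + i)

theorem rising_pos {a : ℝ} (ha : 0 < a) (d : ℕ) : 0 < rising a d :=
  Finset.prod_pos fun _ _ => by positivity

theorem rising_succ (a : ℝ) (d : ℕ) : rising a (d + 1) = rising a d * (a + d) :=
  Finset.prod_range_succ _ _

open Classical in
/-- The reciprocal of the probability of the arcs inserted so far, on the event that they agree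
with `M`. -/
def likelihoodInv (a : ℝ) (M : KOutMap n k) (s : PartialMap n k) : ℝ :=
  if Agrees M s then rising (n * a) (size s) / ∏ j, rising a (inDeg s j) else 0

theorem expect_targetLaw [Nonempty (Fin n)] (α : Set.Ioi (0 : ℝ)) (s : PartialMap n k)
    (g : Fin n → ℝ) :
    expect (targetLaw α s) g =
      (n * (α : ℝ) + size s)⁻¹ * ∑ j, ((α : ℝ) + inDeg s j) * g j := by
  have hα : (0 : ℝ) < α := α.2
  unfold expect
  rw [Finset.mul_sum]
  refine Finset.sum_congr rfl fun j _ => ?_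
  have hsum : ∑' j, weight α s j = ENNReal.ofReal (n * (α : ℝ) + size s) := by
    rw [tsum_fintype]
    unfold weight
    rw [← ENNReal.ofReal_sum_of_nonneg fun _ _ => by positivity]
    congr 1
    simp [Finset.sum_add_distrib, size]
  rw [targetLaw, PMF.normalize_apply, hsum, ENNReal.toReal_mul, ENNReal.toReal_inv, weight,
    ENNReal.toReal_ofReal (by positivity), ENNReal.toReal_ofReal (by positivity)]
  ring

theorem IsInitial.agrees_insertArc_iff {s : PartialMap n k} {o : Fin n → ℕ} (h : IsInitial s o)
    {v : Fin n} (hv : o v < k) (j : Fin n) (M : KOutMap n k) :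
    Agrees M (KOut.insertArc s v j) ↔ Agrees M s ∧ j = M v ⟨o v, hv⟩ := by
  unfold Agrees
  simp only [h.insertArc_apply (i := ⟨o v, hv⟩) rfl]
  constructor
  · intro H
    refine ⟨fun w i => ?_, by simpa using H v ⟨o v, hv⟩⟩
    by_cases e : (w, i) = (v, ⟨o v, hv⟩)
    · left
      obtain ⟨rfl, rfl⟩ := Prod.mk.inj e
      exact h.eq_none rfl
    · simpa [e] using H w i
  · rintro ⟨H, rfl⟩ w i
    by_cases e : (w, i) = (v, ⟨o v, hv⟩)
    · obtain ⟨rfl, rfl⟩ := Prod.mk.inj e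
      simp
    · simpa [e] using H w i

/-- Martingale property: given the selected vertex, exactly one target preserves agreement with `M`,
and its probability is the reciprocal of the factor gained by `likelihoodInv`. The outcome is the
same for every vertex, so the selection rule drops out. -/
theorem IsInitial.expect_step {s : PartialMap n k} {o : Fin n → ℕ} (h : IsInitial s o)
    (α : Set.Ioi (0 : ℝ)) (M : KOutMap n k) :
    expect (step α s) (likelihoodInv α M) = likelihoodInv α M s := by
  have hα : (0 : ℝ) < α := α.2
  unfold step
  split_ifs with hu
  · rw [expect_bind, expect_uniformOfFinset]
    suffices H : ∀ v ∈ unsaturated s, (have : Nonempty (Fin n) := ⟨v⟩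
        expect ((targetLaw α s).map (KOut.insertArc s v)) (likelihoodInv α M)) =
          likelihoodInv α M s by
      rw [Finset.sum_congr rfl H, Finset.sum_const, nsmul_eq_mul, ← mul_assoc, inv_mul_cancel₀,
        one_mul]
      exact_mod_cast hu.card_pos.ne'
    intro v hv
    have hv' := (h.mem_unsaturated v).1 hv
    have : Nonempty (Fin n) := ⟨v⟩
    rw [expect_map, expect_targetLaw]
    by_cases hM : Agrees M s
    · rw [Finset.sum_eq_single (M v ⟨o v, hv'⟩)]
      · set j := M v ⟨o v, hv'⟩
        have hprod : ∏ i, rising (α : ℝ) (inDeg (KOut.insertArc s v j) i) =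
            (∏ i, rising (α : ℝ) (inDeg s i)) * (α + inDeg s j) := by
          have : ∀ i, rising (α : ℝ) (inDeg (KOut.insertArc s v j) i) =
              rising (α : ℝ) (inDeg s i) * if i = j then (α : ℝ) + inDeg s j else 1 := fun i => by
            rw [h.inDeg_insertArc hv']
            split_ifs with e
            · rw [e, rising_succ]
            · simp
          simp only [this, Finset.prod_mul_distrib]
          simp
        have hP : 0 < ∏ i, rising (α : ℝ) (inDeg s i) := Finset.prod_pos fun i _ => rising_pos hα _
        have hag : Agrees M (KOut.insertArc s v j) := (h.agrees_insertArc_iff hv' j M).2 ⟨hM, rfl⟩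
        rw [likelihoodInv, likelihoodInv, if_pos hag, if_pos hM, hprod, h.size_insertArc hv',
          rising_succ]
        have hn : (0 : ℝ) < n := by exact_mod_cast v.pos
        field_simp
      · intro j _ hj
        rw [likelihoodInv, if_neg, mul_zero]
        rw [h.agrees_insertArc_iff hv']
        exact fun H => hj H.2
      · simp
    · have h0 : ∀ j, likelihoodInv α M (KOut.insertArc s v j) = 0 := fun j => by
        rw [likelihoodInv, if_neg]
        rw [h.agrees_insertArc_iff hv']
        exact fun H => hM H.1
      simp only [h0]
      rw [likelihoodInv, if_neg hM]
      simp
  · exact expect_pure _ _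

theorem expect_process (α : Set.Ioi (0 : ℝ)) (M : KOutMap n k) (t : ℕ) :
    expect (process n k α t) (likelihoodInv α M) = 1 := by
  induction t with
  | zero =>
    have : Agrees M (fun _ _ => none : PartialMap n k) := fun _ _ => Or.inl rfl
    rw [process, expect_pure, likelihoodInv, if_pos this]
    simp [size, inDeg, rising]
  | succ t ih =>
    rw [process, expect_bind, ← ih]
    refine expect_congr fun s hs => ?_
    obtain ⟨o, ho, -⟩ := support_process α t hs
    exact ho.expect_step α M

/-- At the terminal time the martingale is a constant times the indicator of `M`, and its mean is
still 1. No summation over insertion orders is needed. -/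
theorem prefLaw_apply (α : Set.Ioi (0 : ℝ)) (M : KOutMap n k) :
    (prefLaw n k α M).toReal =
      (∏ j, rising α (inDeg (fun v i => some (M v i)) j)) / rising (n * (α : ℝ)) (n * k) := by
  classical
  have hα : (0 : ℝ) < α := α.2
  set S : PartialMap n k := fun v i => some (M v i) with hS
  have hsize : size S = n * k := by simp [size_eq_card, hS]
  have h1 := expect_process α M (k * n)
  have h2 : expect (process n k α (k * n)) (likelihoodInv α M) =
      expect (process n k α (k * n)) fun s =>
        likelihoodInv α M S * if toKOutMap s = M then 1 else 0 := by
    refine expect_congr fun s hs => ?_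
    have hfull := isSome_of_mem_support α hs
    by_cases hM : toKOutMap s = M
    · have : s = S := by
        funext v i
        obtain ⟨j, hj⟩ := Option.isSome_iff_exists.1 (hfull v i)
        rw [hS, ← hM]
        simp [toKOutMap, hj]
      rw [if_pos hM, mul_one, this]
    · rw [if_neg hM, mul_zero, likelihoodInv, if_neg]
      intro H
      apply hM
      funext v i
      rcases H v i with e | e
      · have := hfull v i
        rw [e] at this
        simp at this
      · simp [toKOutMap, e]
  have h3 : expect (process n k α (k * n)) (fun s =>
      likelihoodInv α M S * if toKOutMap s = M then 1 else 0) =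
      likelihoodInv α M S * (prefLaw n k α M).toReal := by
    rw [prefLaw, ← expect_single, expect_map, expect, expect, Finset.mul_sum]
    exact Finset.sum_congr rfl fun s _ => by ring
  have hag : Agrees M S := fun _ _ => Or.inr rfl
  rw [h2, h3, likelihoodInv, if_pos hag, hsize] at h1
  have hP : 0 < ∏ i, rising (α : ℝ) (inDeg S i) := Finset.prod_pos fun i _ => rising_pos hα _
  have hR : rising (n * (α : ℝ)) (n * k) ≠ 0 := fun e => by simp [e] at h1
  field_simp at h1 ⊢
  linarith

end process

/-! ### From maps to words. -/

section word

variable {n k : ℕ}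

/-- The targets of the arcs of a `k`-out map, as a word. -/
def word (M : KOutMap n k) : List (Fin n) :=
  List.ofFn fun i : Fin (n * k) => M (finProdFinEquiv.symm i).1 (finProdFinEquiv.symm i).2

theorem count_ofFn {N : ℕ} (f : Fin N → Fin n) (j : Fin n) :
    (List.ofFn f).count j = ∑ i, if f i = j then 1 else 0 := by
  induction N with
  | zero => simp
  | succ N ih =>
    rw [List.ofFn_succ, List.count_cons, ih, Fin.sum_univ_succ, add_comm]
    simp

theorem count_word (M : KOutMap n k) (j : Fin n) :
    (word M).count j = inDeg (fun v i => some (M v i)) j := by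
  rw [word, count_ofFn, inDeg, Finset.card_filter,
    finProdFinEquiv.symm.sum_comp (fun a : Fin n × Fin k => if M a.1 a.2 = j then 1 else 0)]
  simp

theorem sum_word {V : Type} [AddCommMonoid V] (F : List (Fin n) → V) :
    ∑ M : KOutMap n k, F (word M) = ∑ f : Fin (n * k) → Fin n, F (List.ofFn f) := by
  refine Fintype.sum_equiv ((Equiv.curry (Fin n) (Fin k) (Fin n)).symm.trans
    (finProdFinEquiv.arrowCongr (Equiv.refl _))) _ _ fun M => ?_
  rfl

/-- The factors `a + count`, grouped by letter, form rising factorials; hence the order of the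
letters does not matter. -/
theorem exp_cumul_log {a : ℝ} (ha : 0 < a) (l : List (Fin n)) :
    Real.exp (cumul (fun j l => Real.log (1 + l.count j / a)) l) * a ^ l.length =
      ∏ j, rising a (l.count j) := by
  induction l with
  | nil => simp [cumul, rising]
  | cons b l ih =>
    have : ∀ j, rising a ((b :: l).count j) =
        rising a (l.count j) * if b = j then a + l.count j else 1 := fun j => by
      rw [List.count_cons]
      by_cases e : b = j
      · subst e; simp [rising_succ]
      · simp [e]
    simp only [this, Finset.prod_mul_distrib, ← ih, cumul]
    rw [Real.exp_add, Real.exp_log (by positivity), List.length_cons, pow_succ]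
    simp
    field_simp

theorem exp_sum_log {a : ℝ} (ha : 0 < a) (hn : n ≠ 0) (N : ℕ) :
    Real.exp (∑ m ∈ Finset.range N, Real.log (1 + m / n / a)) * (n * a) ^ N =
      rising (n * a) N := by
  have hn' : (0 : ℝ) < n := by exact_mod_cast Nat.pos_of_ne_zero hn
  induction N with
  | zero => simp [rising]
  | succ N ih =>
    rw [Finset.sum_range_succ, Real.exp_add, Real.exp_log (by positivity), rising_succ, ← ih,
      pow_succ]
    field_simp

theorem prefLaw_eq_exp_logRatio (hn : n ≠ 0) (α : Set.Ioi (0 : ℝ)) (M : KOutMap n k) :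
    (prefLaw n k α M).toReal = ((n : ℝ) ^ (n * k))⁻¹ * Real.exp (logRatio α (word M)) := by
  have hα : (0 : ℝ) < α := α.2
  have hn' : (0 : ℝ) < n := by exact_mod_cast Nat.pos_of_ne_zero hn
  have hl : (word M).length = n * k := by simp [word]
  rw [prefLaw_apply, logRatio, Real.exp_sub]
  simp only [← count_word]
  rw [← exp_cumul_log hα, ← exp_sum_log hα hn, hl, mul_pow]
  field_simp

theorem unifLaw_apply (M : KOutMap n k) :
    (unifLaw n k M).toReal = ((n : ℝ) ^ (n * k))⁻¹ := by
  rw [unifLaw, PMF.uniformOfFintype_apply]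
  simp only [Fintype.card_fun, Fintype.card_fin, ENNReal.toReal_inv, ENNReal.toReal_natCast]
  rw [← pow_mul, mul_comm]
  push_cast
  rfl

end word

/-! ### Total variation on a finite space. -/

section tvDist

variable {Ω : Type} [Fintype Ω]

theorem sum_toReal (p : PMF Ω) : ∑ x, (p x).toReal = 1 := by
  rw [← ENNReal.toReal_sum fun a _ => p.apply_ne_top a, ← tsum_fintype (L := .unconditional _),
    p.tsum_coe, ENNReal.toReal_one]

theorem tvDist_eq (p q : PMF Ω) :
    tvDist p q = 1 / 2 * ∑ x, |(p x).toReal - (q x).toReal| := by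
  classical
  set d : Ω → ℝ := fun x => (p x).toReal - (q x).toReal
  have hd : ∑ x, d x = 0 := by simp only [d, Finset.sum_sub_distrib, sum_toReal, sub_self]
  have hA : ∀ (r : PMF Ω) (A : Set Ω), (r.toOuterMeasure A).toReal =
      ∑ x, if x ∈ A then (r x).toReal else 0 := fun r A => by
    rw [PMF.toOuterMeasure_apply_fintype, ENNReal.toReal_sum]
    · refine Finset.sum_congr rfl fun x _ => ?_
      by_cases hx : x ∈ A <;> simp [hx]
    · intro x _
      by_cases hx : x ∈ A <;> simp [hx, r.apply_ne_top]
  have hdiff : ∀ A : Set Ω, (p.toOuterMeasure A).toReal - (q.toOuterMeasure A).toReal =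
      ∑ x, if x ∈ A then d x else 0 := fun A => by
    rw [hA, hA, ← Finset.sum_sub_distrib]
    refine Finset.sum_congr rfl fun x _ => ?_
    by_cases hx : x ∈ A <;> simp [hx, d]
  have hle : ∀ A : Set Ω, |(p.toOuterMeasure A).toReal - (q.toOuterMeasure A).toReal| ≤
      1 / 2 * ∑ x, |d x| := fun A => by
    rw [hdiff]
    -- Subtracting half of `∑ d = 0` gives every point weight `±1/2`, whence the bound.
    have h1 : ∑ x, (if x ∈ A then d x else 0) = ∑ x, (if x ∈ A then d x / 2 else -(d x / 2)) := by
      have : ∑ x, (if x ∈ A then d x / 2 else -(d x / 2)) =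
          ∑ x, (if x ∈ A then d x else 0) - (∑ x, d x) / 2 := by
        rw [Finset.sum_div, ← Finset.sum_sub_distrib]
        refine Finset.sum_congr rfl fun x _ => ?_
        by_cases hx : x ∈ A
        · simp only [hx, if_true]; ring
        · simp [hx]
      rw [this, hd]
      simp
    rw [h1, Finset.mul_sum]
    refine (Finset.abs_sum_le_sum_abs _ _).trans (Finset.sum_le_sum fun x _ => le_of_eq ?_)
    by_cases hx : x ∈ A <;> simp [hx, abs_div] <;> ring
  unfold tvDist
  have hbdd : BddAbove (Set.range fun A : Set Ω =>
      |(p.toOuterMeasure A).toReal - (q.toOuterMeasure A).toReal|) :=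
    ⟨_, Set.forall_mem_range.2 hle⟩
  refine le_antisymm (ciSup_le hle) (le_ciSup_of_le hbdd {x | 0 ≤ d x} ?_)
  · refine le_trans (le_of_eq ?_) (le_abs_self _)
    rw [hdiff]
    calc 1 / 2 * ∑ x, |d x| = 1 / 2 * ∑ x, |d x| + 1 / 2 * ∑ x, d x := by rw [hd]; simp
      _ = _ := by
        rw [Finset.mul_sum, Finset.mul_sum, ← Finset.sum_add_distrib]
        refine Finset.sum_congr rfl fun x _ => ?_
        by_cases hx : 0 ≤ d x
        · simp [hx, abs_of_nonneg hx]
          ring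
        · simp [hx, abs_of_neg (not_le.1 hx)]

/-- Equal total masses let either positive part be used; this one makes the integrand `(1 -
density)⁺`, which is bounded. -/
theorem tvDist_eq_sum_max (p q : PMF Ω) :
    tvDist p q = ∑ x, max 0 ((q x).toReal - (p x).toReal) := by
  have h : ∀ x, max 0 ((q x).toReal - (p x).toReal) =
      1 / 2 * (|(p x).toReal - (q x).toReal| + ((q x).toReal - (p x).toReal)) := fun x => by
    rcases le_total 0 ((q x).toReal - (p x).toReal) with h | h
    · rw [max_eq_right h, abs_of_nonpos (by linarith)]; ring
    · rw [max_eq_left h, abs_of_nonneg (by linarith)]; ring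
  simp only [h]
  rw [← Finset.mul_sum, Finset.sum_add_distrib, Finset.sum_sub_distrib, sum_toReal, sum_toReal,
    tvDist_eq]
  ring

end tvDist

theorem tvDist_eq_avg {n : ℕ} (k : ℕ) (hn : n ≠ 0) (α : Set.Ioi (0 : ℝ)) :
    tvDist (prefLaw n k α) (unifLaw n k) =
      avg n (n * k) fun l => deficit (logRatio α l) := by
  rw [tvDist_eq_sum_max, avg, ← sum_word (fun l => deficit (logRatio α l)), Finset.smul_sum]
  refine Finset.sum_congr rfl fun M _ => ?_
  rw [prefLaw_eq_exp_logRatio hn, unifLaw_apply, deficit, smul_eq_mul,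
    mul_max_of_nonneg _ _ (by positivity)]
  congr 1 <;> ring

end KOut

end

theorem theorem1 (k : ℕ) (hk : 1 ≤ k) (α : ℕ → Set.Ioi (0 : ℝ)) :
    (∀ n : ℕ, KOut.tvDist (KOut.prefLaw n k (α n)) (KOut.unifLaw n k) =
      1 / 2 * ∑ M : KOut.KOutMap n k,
        |(KOut.prefLaw n k (α n) M).toReal - (KOut.unifLaw n k M).toReal|) ∧
    (Tendsto (fun n : ℕ => (α n : ℝ) / √(n : ℝ)) atTop atTop →
      Tendsto (fun n : ℕ => KOut.tvDist (KOut.prefLaw n k (α n)) (KOut.unifLaw n k))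
        atTop (𝓝 0)) ∧
    (Tendsto (fun n : ℕ => (α n : ℝ)) atTop atTop →
      Tendsto (fun n : ℕ => (α n : ℝ) / √(n : ℝ)) atTop (𝓝 0) →
      Tendsto (fun n : ℕ => KOut.tvDist (KOut.prefLaw n k (α n)) (KOut.unifLaw n k))
        atTop (𝓝 1)) ∧
    (∀ β : ℝ, 0 < β → (∀ n : ℕ, 1 ≤ n → (α n : ℝ) = β * √(n : ℝ)) →
      Tendsto (fun n : ℕ => KOut.tvDist (KOut.prefLaw n k (α n)) (KOut.unifLaw n k))
        atTop (𝓝 (1 / 2 * ∫ x : ℝ, |1 - Real.exp (-x)|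
          ∂(gaussianReal ((k : ℝ) ^ 2 / (4 * β ^ 2))
            (Real.toNNReal ((k : ℝ) ^ 2 / (2 * β ^ 2))))))) := by
  have hev : (fun n : ℕ => KOut.avg n (n * k) fun l => KOut.deficit (KOut.logRatio (α n) l))
      =ᶠ[atTop] fun n : ℕ => KOut.tvDist (KOut.prefLaw n k (α n)) (KOut.unifLaw n k) := by
    filter_upwards [eventually_ne_atTop 0] with n hn
    exact (KOut.tvDist_eq_avg k hn (α n)).symm
  have hα : ∀ n, (0 : ℝ) < α n := fun n => (α n).2
  refine ⟨fun n => KOut.tvDist_eq _ _, fun h => ?_, fun h h' => ?_, fun β hβ h => ?_⟩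
  · exact (KOut.tendsto_avg_deficit_zero k _ hα h).congr' hev
  · exact (KOut.tendsto_avg_deficit_one k _ hα hk h h').congr' hev
  · exact (KOut.tendsto_avg_deficit_gaussian k _ hα hβ h).congr' hev
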